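/- Let $p_+,p_-\ge 2$ be coprime integers and put $$\alpha_+=\sqrt{\tfrac{2p_-}{p_+}},\quad \alpha_-=-\sqrt{\tfrac{2p_+}{p_-}},\quad \alpha_0=\alpha_++\alpha_-,\quad \alpha=\sqrt{2p_+p_-},\quad \alpha_{r,s;n}=\tfrac{1-r}{2}\alpha_++\tfrac{1-s}{2}\alpha_-+\tfrac n2\alpha .$$ **Regularised characters.** Let $\epsilon\in\mathbb C$, $\operatorname{Im}\tau>0$, $q=e^{2\pi i\tau}$, and let $\eta$ be the Dedekind eta function. For $\lambda\in\mathbb C$ the regularised character of the Fock module $\mathcal F_\lambda$ is $$\mathrm{ch}[\mathcal F_\lambda^\epsilon](\tau)=e^{2\pi\epsilon(\lambda-\alpha_0/2)}\,\frac{q^{(\lambda-\alpha_0/2)^2/2}}{\eta(\tau)},$$ and $\mathcal F_{r,s;n}:=\mathcal F_{\alpha_{r,s;n}}$. Omitting $\epsilon$ means $\epsilon=0$. The Virasoro minimal model modules $\mathcal L_{r,s}$ ($1\le r<p_+$, $1\le s<p_-$) have the unregularised characters $$\mathrm{ch}[\mathcal L_{r,s}]=\sum_{k\in\mathbb Z}\big(\mathrm{ch}[\mathcal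 F_{r,s;2k}]-\mathrm{ch}[\mathcal F_{p_+-r,s;2k+1}]\big).$$ For $1\le r\le p_+$, $1\le s\le p_-$, $n\in\mathbb Z$ the regularised character of the singlet module $\mathcal I_{r,s;n}$ is as follows. If $r<p_+$ and $s<p_-$, $$\mathrm{ch}[\mathcal I_{r,s;n}^\epsilon]=n\,\delta_{n\ge 0}\big(\delta_{n\text{ even}}\mathrm{ch}[\mathcal L_{r,s}]-\delta_{n\text{ odd}}\mathrm{ch}[\mathcal L_{r,p_--s}]\big)$$ $$+\sum_{k\ge0}(k+1)\big(\mathrm{ch}[\mathcal F^\epsilon_{p_+-r,s;n-2k-1}]+\mathrm{ch}[\mathcal F^\epsilon_{r,p_--s;n-2k-3}]-\mathrm{ch}[\mathcal F^\epsilon_{r,s;n-2k-2}]-\mathrm{ch}[\mathcal F^\epsilon_{p_+-r,p_--s;n-2k-2}]\big).$$ On the border, for $r<p_+$ and $s<p_-$, $$\mathrm{ch}[\mathcal I_{r,p_-;n}^\epsilon]=\sum_{k\ge0}\big(\mathrm{ch}[\mathcal F^\epsilon_{p_+-r,p_-;n-2k-1}]-\mathrm{ch}[\mathcal F^\epsilon_{r,p_-;n-2k-2}]\big),$$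 $$\mathrm{ch}[\mathcal I_{p_+,s;n}^\epsilon]=\sum_{k\ge0}\big(\mathrm{ch}[\mathcal F^\epsilon_{p_+,s;n-2k}]-\mathrm{ch}[\mathcal F^\epsilon_{p_+,p_--s;n-2k-1}]\big),$$ and $\mathcal I_{p_+,p_-;n}=\mathcal F_{p_+,p_-;n}$. The singlet vertex operator algebra $\mathcal K=\mathcal K_{1,1;0}$ has $\mathrm{ch}[\mathcal K^\epsilon]=\mathrm{ch}[\mathcal L_{1,1}]+\mathrm{ch}[\mathcal I^\epsilon_{1,1;0}]$. **Quantum dimensions.** The regularised quantum dimension of $M$ is $$\mathrm{qdim}[M^\epsilon]=\lim_{y\to0^+}\frac{\mathrm{ch}[M^\epsilon](iy)}{\mathrm{ch}[\mathcal K^\epsilon](iy)}.$$ Put $B_\epsilon=-\min\{\,|m/\sqrt{2p_+p_-}-\operatorname{Im}\epsilon| : m\in\mathbb Z\setminus p_+p_-\mathbb Z\,\}$. **Theorem.** Suppose that either $\operatorname{Re}\epsilon>B_\epsilon$ and $\operatorname{Re}\epsilon\ne0$, or $\operatorname{Re}\epsilon<B_\epsilon$ and the minimum defining $B_\epsilon$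 is attained at exactly one $m$. Then $\mathrm{ch}[\mathcal K^\epsilon](iy)\neq 0$ for all sufficiently small $y>0$; the limits defining $\mathrm{qdim}[\mathcal F_\lambda^\epsilon]$ and $\mathrm{qdim}[\mathcal I_{r,s;n}^\epsilon]$ exist for all $\lambda\in\mathbb C$, $1\le r\le p_+$, $1\le s\le p_-$, $n\in\mathbb Z$; and for all $\lambda,\mu\in\mathbb C$, all such $r,s,n$ and all $m\in\mathbb Z$ $$\mathrm{qdim}[\mathcal F_\lambda^\epsilon]\,\mathrm{qdim}[\mathcal F_\mu^\epsilon]=\sum_{j_+=0}^{p_+-1}\sum_{j_-=0}^{p_--1}\mathrm{qdim}[\mathcal F^\epsilon_{\lambda+\mu+j_+\alpha_++j_-\alpha_-}],$$ $$\mathrm{qdim}[\mathcal I_{r,s;n}^\epsilon]\,\mathrm{qdim}[\mathcal F_\mu^\epsilon]=\sum_{j_+=0}^{r-1}\sum_{j_-=0}^{s-1}\mathrm{qdim}[\mathcal F^\epsilon_{\mu+\alpha_{r-2j_+,s-2j_-;n}}],$$ $$\mathrm{qdim}[\mathcal I_{1,1;m}^\epsilon]\,\mathrm{qdim}[\mathcal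 I_{r,s;n}^\epsilon]=\mathrm{qdim}[\mathcal I_{r,s;m+n}^\epsilon],$$ $$\mathrm{qdim}[\mathcal I_{2,1;0}^\epsilon]\,\mathrm{qdim}[\mathcal I_{r,s;n}^\epsilon]=\begin{cases}\mathrm{qdim}[\mathcal I_{2,s;n}^\epsilon]& r=1,\\ \mathrm{qdim}[\mathcal I_{r-1,s;n}^\epsilon]+\mathrm{qdim}[\mathcal I_{r+1,s;n}^\epsilon]&1<r<p_+,\\ \mathrm{qdim}[\mathcal I_{1,s;n-1}^\epsilon]+2\,\mathrm{qdim}[\mathcal I_{p_+-1,s;n}^\epsilon]+\mathrm{qdim}[\mathcal I_{1,s;n+1}^\epsilon]& r=p_+,\end{cases}$$ $$\mathrm{qdim}[\mathcal I_{1,2;0}^\epsilon]\,\mathrm{qdim}[\mathcal I_{r,s;n}^\epsilon]=\begin{cases}\mathrm{qdim}[\mathcal I_{r,2;n}^\epsilon]& s=1,\\ \mathrm{qdim}[\mathcal I_{r,s-1;n}^\epsilon]+\mathrm{qdim}[\mathcal I_{r,s+1;n}^\epsilon]&1<s<p_-,\\ \mathrm{qdim}[\mathcal I_{r,1;n-1}^\epsilon]+2\,\mathrm{qdim}[\mathcal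 I_{r,p_--1;n}^\epsilon]+\mathrm{qdim}[\mathcal I_{r,1;n+1}^\epsilon]& s=p_-.\end{cases}$$ -/

import Mathlib

open Filter Topology Complex

namespace Singlet

/-- `α₊ = √(2p₋/p₊)`. -/
noncomputable def alphaPlus (pp pm : ℕ) : ℝ := Real.sqrt (2 * pm / pp)

/-- `α₋ = -√(2p₊/p₋)`. -/
noncomputable def alphaMinus (pp pm : ℕ) : ℝ := -Real.sqrt (2 * pp / pm)

/-- `α₀ = α₊ + α₋`. -/
noncomputable def alphaZero (pp pm : ℕ) : ℝ := alphaPlus pp pm + alphaMinus pp pm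

/-- `α = p₊α₊ = -p₋α₋ = √(2p₊p₋)`. -/
noncomputable def alphaFull (pp pm : ℕ) : ℝ := Real.sqrt (2 * pp * pm)

/-- The Kac labels `α_{r,s;n} = (1-r)/2 α₊ + (1-s)/2 α₋ + n/2 α`. -/
noncomputable def alphaIdx (pp pm : ℕ) (r s n : ℤ) : ℝ :=
  (1 - r) / 2 * alphaPlus pp pm + (1 - s) / 2 * alphaMinus pp pm + n / 2 * alphaFull pp pm

/-- The regularised character of the Fock module `F_lam`,
`e^{2πε(lam - α₀/2)} q^{(lam - α₀/2)²/2} / η(τ)`, `q = e^{2πiτ}`, for `Im τ > 0`.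
At `ε = 0` it is the unregularised character. -/
noncomputable def fockCh (pp pm : ℕ) (ε lam τ : ℂ) : ℂ :=
  exp (2 * Real.pi * ε * (lam - alphaZero pp pm / 2)) *
    exp (2 * Real.pi * I * τ * ((lam - alphaZero pp pm / 2) ^ 2 / 2)) / ModularForm.eta τ

/-- The regularised character of `F_{r,s;n} = F_{α_{r,s;n}}`. -/
noncomputable def fockIdxCh (pp pm : ℕ) (ε : ℂ) (r s n : ℤ) (τ : ℂ) : ℂ :=
  fockCh pp pm ε (alphaIdx pp pm r s n) τ

/-- The (unregularised) character of the Virasoro minimal model module `L_{r,s}`,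
`1 ≤ r < p₊`, `1 ≤ s < p₋`: the Euler characteristic of its Felder complex,
equal to `(θ_{p₊p₋,-rp₋+sp₊}(τ) - θ_{p₊p₋,rp₋+sp₊}(τ)) / η(τ)`. -/
noncomputable def virCh (pp pm : ℕ) (r s : ℤ) (τ : ℂ) : ℂ :=
  ∑' k : ℤ, (fockIdxCh pp pm 0 r s (2 * k) τ - fockIdxCh pp pm 0 (pp - r) s (2 * k + 1) τ)

/-- The regularised character of `I⁺_{r,s;n}`, `1 ≤ r < p₊`, `1 ≤ s ≤ p₋`. -/
noncomputable def imPlusCh (pp pm : ℕ) (ε : ℂ) (r s n : ℤ) (τ : ℂ) : ℂ :=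
  (if s ≠ pm ∧ 1 ≤ n then
    (if Even n then virCh pp pm r s τ else -virCh pp pm r (pm - s) τ) else 0) +
  ∑' k : ℕ, (fockIdxCh pp pm ε (pp - r) s (n - 2 * k - 1) τ
    - fockIdxCh pp pm ε r s (n - 2 * k - 2) τ)

/-- The regularised character of `I⁻_{r,s;n}`, `1 ≤ r ≤ p₊`, `1 ≤ s < p₋`. -/
noncomputable def imMinusCh (pp pm : ℕ) (ε : ℂ) (r s n : ℤ) (τ : ℂ) : ℂ :=
  (if r ≠ pp ∧ 0 ≤ n then
    (if Even n then -virCh pp pm r s τ else virCh pp pm r (pm - s) τ) else 0) +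
  ∑' k : ℕ, (fockIdxCh pp pm ε r s (n - 2 * k) τ
    - fockIdxCh pp pm ε r (pm - s) (n - 2 * k - 1) τ)

/-- The regularised character of `I_{r,s;n}`, `1 ≤ r ≤ p₊`, `1 ≤ s ≤ p₋`. On the border,
`I_{p₊,p₋;n} = F_{p₊,p₋;n}`, `I_{p₊,s;n} = I⁻_{p₊,s;n}` and `I_{r,p₋;n} = I⁺_{r,p₋;n}`. -/
noncomputable def imCh (pp pm : ℕ) (ε : ℂ) (r s n : ℤ) (τ : ℂ) : ℂ :=
  if r = pp ∧ s = pm then fockIdxCh pp pm ε r s n τ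
  else if r = pp then imMinusCh pp pm ε r s n τ
  else if s = pm then imPlusCh pp pm ε r s n τ
  else
    (if 0 ≤ n then
      (n : ℂ) * (if Even n then virCh pp pm r s τ else -virCh pp pm r (pm - s) τ) else 0) +
    ∑' k : ℕ, ((k : ℂ) + 1) *
      (fockIdxCh pp pm ε (pp - r) s (n - 2 * k - 1) τ
        + fockIdxCh pp pm ε r (pm - s) (n - 2 * k - 3) τ
        - fockIdxCh pp pm ε r s (n - 2 * k - 2) τ
        - fockIdxCh pp pm ε (pp - r) (pm - s) (n - 2 * k - 2) τ)

/-- The regularised character of the singlet algebra `K_{1,1;0}` itself: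
`ch[L_{1,1}] + ch[I_{1,1;0}^ε]`. -/
noncomputable def vacCh (pp pm : ℕ) (ε τ : ℂ) : ℂ :=
  virCh pp pm 1 1 τ + imCh pp pm ε 1 1 0 τ

/-- `d` is the regularised quantum dimension of a module with regularised character `ch`:
the limit of `ch(iy) / ch[K_{1,1;0}^ε](iy)` as `y → 0⁺` exists and equals `d`. -/
def HasQdim (pp pm : ℕ) (ε : ℂ) (ch : ℂ → ℂ) (d : ℂ) : Prop :=
  Tendsto (fun y : ℝ => ch (I * y) / vacCh pp pm ε (I * y)) (𝓝[>] (0 : ℝ)) (𝓝 d)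

/-- The regularised quantum dimension of a module with regularised character `ch`. -/
noncomputable def qdim (pp pm : ℕ) (ε : ℂ) (ch : ℂ → ℂ) : ℂ :=
  limUnder (𝓝[>] (0 : ℝ)) (fun y : ℝ => ch (I * y) / vacCh pp pm ε (I * y))

/-- `qdim[F_lam^ε]`. -/
noncomputable def qdimFock (pp pm : ℕ) (ε lam : ℂ) : ℂ :=
  qdim pp pm ε (fockCh pp pm ε lam)

/-- `qdim[I_{r,s;n}^ε]`. -/
noncomputable def qdimIm (pp pm : ℕ) (ε : ℂ) (r s n : ℤ) : ℂ :=
  qdim pp pm ε (imCh pp pm ε r s n)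

/-- The distance from `Im ε` to the point `m / √(2p₊p₋)`. -/
noncomputable def wallDist (pp pm : ℕ) (ε : ℂ) (m : ℤ) : ℝ :=
  |m / alphaFull pp pm - ε.im|

/-- The wall `B_ε = -min {|m/√(2p₊p₋) - Im ε| : m ∈ ℤ ∖ p₊p₋ℤ}`. -/
noncomputable def wall (pp pm : ℕ) (ε : ℂ) : ℝ :=
  -⨅ m : {m : ℤ // ¬ ((pp * pm : ℤ) ∣ m)}, wallDist pp pm ε m

/-- The regularisation parameters under consideration: to the right of the wall, off the
imaginary axis; or to the left of the wall, such that the minimum defining the wall is attained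
at only one `m`. -/
def Admissible (pp pm : ℕ) (ε : ℂ) : Prop :=
  (wall pp pm ε < ε.re ∧ ε.re ≠ 0) ∨
  (ε.re < wall pp pm ε ∧
    ∃! m : ℤ, ¬ ((pp * pm : ℤ) ∣ m) ∧ wallDist pp pm ε m = -wall pp pm ε)

end Singlet

namespace Singlet

lemma hasSum_of_eq {ι : Type*} {f g : ι → ℂ} {a b : ℂ} (h : HasSum f a) (hf : ∀ m, g m = f m)
    (hb : b = a) : HasSum g b := by
  rw [hb, show g = f from funext hf]
  exact h

/-- The Gaussian `e^{2πεx - πyx²}`, the numerator of a regularised Fock character at `τ = iy`. -/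
noncomputable def gauss (ε x : ℂ) (y : ℝ) : ℂ := exp (2 * Real.pi * ε * x - Real.pi * y * x ^ 2)

lemma gauss_add_mul_int (ε a : ℂ) (L y : ℝ) (j : ℤ) :
    gauss ε (a + L * j) y =
      gauss ε a y * jacobiTheta₂_term j (-I * L * (ε - y * a)) (I * y * L ^ 2) := by
  rw [gauss, gauss, jacobiTheta₂_term, ← Complex.exp_add]
  congr 1
  linear_combination (2 * Real.pi * j * L * (ε - y * a) - Real.pi * j ^ 2 * y * L ^ 2) * I_sq

lemma im_I_mul_mul_sq_pos {L y : ℝ} (hL : 0 < L) (hy : 0 < y) : 0 < (I * y * L ^ 2 : ℂ).im := by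
  have : (I * y * L ^ 2 : ℂ) = ((y * L ^ 2 : ℝ) : ℂ) * I := by push_cast; ring
  rw [this, Complex.im_ofReal_mul, I_im, mul_one]
  positivity

lemma im_neg_one_div_pos {L y : ℝ} (hL : 0 < L) (hy : 0 < y) :
    0 < (-1 / (I * y * L ^ 2 : ℂ)).im := by
  have : (-1 / (I * y * L ^ 2 : ℂ)) = ((1 / (y * L ^ 2) : ℝ) : ℂ) * I := by
    have hL' : (L : ℂ) ≠ 0 := by exact_mod_cast hL.ne'
    have hy' : (y : ℂ) ≠ 0 := by exact_mod_cast hy.ne'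
    have hI := I_ne_zero
    push_cast
    field_simp
    linear_combination -I_sq
  rw [this, Complex.im_ofReal_mul, I_im, mul_one]
  positivity

lemma hasSum_gauss_theta (ε a : ℂ) {L y : ℝ} (hL : 0 < L) (hy : 0 < y) :
    HasSum (fun j : ℤ => gauss ε (a + L * j) y)
      (gauss ε a y * jacobiTheta₂ (-I * L * (ε - y * a)) (I * y * L ^ 2)) := by
  simp only [gauss_add_mul_int]
  exact (hasSum_jacobiTheta₂_term _ (im_I_mul_mul_sq_pos hL hy)).mul_left _

lemma hasSum_int_mul_gauss_theta (ε a : ℂ) {L y : ℝ} (hL : 0 < L) (hy : 0 < y) :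
    HasSum (fun j : ℤ => (j : ℂ) * gauss ε (a + L * j) y)
      (gauss ε a y / (2 * Real.pi * I) *
        jacobiTheta₂' (-I * L * (ε - y * a)) (I * y * L ^ 2)) := by
  have h := (hasSum_jacobiTheta₂'_term (-I * L * (ε - y * a))
    (im_I_mul_mul_sq_pos hL hy)).mul_left (gauss ε a y / (2 * Real.pi * I))
  have hπ : (Real.pi : ℂ) ≠ 0 := by exact_mod_cast Real.pi_ne_zero
  have hI := I_ne_zero
  refine hasSum_of_eq h (fun j => ?_) rfl
  rw [gauss_add_mul_int, jacobiTheta₂'_term]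
  field_simp

lemma cpow_half_eq {L y : ℝ} (hL : 0 < L) (hy : 0 < y) :
    (-I * (I * y * L ^ 2) : ℂ) ^ (1 / 2 : ℂ) = L * (Real.sqrt y : ℝ) := by
  have h1 : (-I * (I * y * L ^ 2) : ℂ) = ((y * L ^ 2 : ℝ) : ℂ) := by
    push_cast; linear_combination (-(y * L ^ 2 : ℂ)) * I_sq
  have h2 : (1 / 2 : ℂ) = ((1 / 2 : ℝ) : ℂ) := by push_cast; ring
  rw [h1, h2, ← Complex.ofReal_cpow (by positivity), ← Real.sqrt_eq_rpow,
    Real.sqrt_mul hy.le, Real.sqrt_sq hL.le]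
  push_cast; ring

/-- The dual Gaussian `e^{π(ε - im/L)²/y}` of Poisson summation. -/
noncomputable def dualGauss (L : ℝ) (ε : ℂ) (m : ℤ) (y : ℝ) : ℂ :=
  exp (Real.pi * (ε - I * m / L) ^ 2 / y)

lemma gauss_mul_exp_mul_term (ε a : ℂ) {L y : ℝ} (hL : 0 < L) (hy : 0 < y) (m : ℤ) :
    gauss ε a y * exp (-Real.pi * I * (-I * L * (ε - y * a)) ^ 2 / (I * y * L ^ 2)) *
      jacobiTheta₂_term m ((-I * L * (ε - y * a)) / (I * y * L ^ 2)) (-1 / (I * y * L ^ 2)) =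
    dualGauss L ε m y * exp (2 * Real.pi * I * m * a / L) := by
  have hL' : (L : ℂ) ≠ 0 := by exact_mod_cast hL.ne'
  have hy' : (y : ℂ) ≠ 0 := by exact_mod_cast hy.ne'
  rw [gauss, jacobiTheta₂_term, dualGauss, ← Complex.exp_add, ← Complex.exp_add,
    ← Complex.exp_add]
  congr 1
  have hI := I_ne_zero
  field_simp
  ring_nf
  simp only [I_sq]
  ring

lemma hasSum_gauss_dual (ε a : ℂ) {L y : ℝ} (hL : 0 < L) (hy : 0 < y) :
    HasSum (fun m : ℤ => 1 / (L * (Real.sqrt y : ℝ)) *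
        (dualGauss L ε m y * exp (2 * Real.pi * I * m * a / L)))
      (∑' j : ℤ, gauss ε (a + L * j) y) := by
  have hτ := im_neg_one_div_pos hL hy
  rw [(hasSum_gauss_theta ε a hL hy).tsum_eq, jacobiTheta₂_functional_equation,
    cpow_half_eq hL hy]
  have h := (hasSum_jacobiTheta₂_term ((-I * L * (ε - y * a)) / (I * y * L ^ 2)) hτ).mul_left
    (1 / (L * (Real.sqrt y : ℝ)) * (gauss ε a y *
      exp (-Real.pi * I * (-I * L * (ε - y * a)) ^ 2 / (I * y * L ^ 2))))
  refine hasSum_of_eq h (fun m => ?_) ?_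
  · rw [← gauss_mul_exp_mul_term ε a hL hy m]; ring
  · ring

lemma hasSum_int_mul_gauss_dual (ε a : ℂ) {L y : ℝ} (hL : 0 < L) (hy : 0 < y) :
    HasSum (fun m : ℤ => (ε - I * m / L - y * a) / (L ^ 2 * (y * (Real.sqrt y : ℝ))) *
        (dualGauss L ε m y * exp (2 * Real.pi * I * m * a / L)))
      (∑' j : ℤ, (j : ℂ) * gauss ε (a + L * j) y) := by
  have hL' : (L : ℂ) ≠ 0 := by exact_mod_cast hL.ne'
  have hy' : (y : ℂ) ≠ 0 := by exact_mod_cast hy.ne'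
  have hI := I_ne_zero
  have hπ : (Real.pi : ℂ) ≠ 0 := by exact_mod_cast Real.pi_ne_zero
  have hs : ((Real.sqrt y : ℝ) : ℂ) ≠ 0 := by exact_mod_cast (Real.sqrt_pos.2 hy).ne'
  have hτ := im_neg_one_div_pos hL hy
  rw [(hasSum_int_mul_gauss_theta ε a hL hy).tsum_eq, jacobiTheta₂'_functional_equation,
    cpow_half_eq hL hy]
  have h := ((hasSum_jacobiTheta₂'_term ((-I * L * (ε - y * a)) / (I * y * L ^ 2)) hτ).sub
    ((hasSum_jacobiTheta₂_term ((-I * L * (ε - y * a)) / (I * y * L ^ 2)) hτ).mul_left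
      (2 * Real.pi * I * (-I * L * (ε - y * a))))).mul_left
    (1 / (L * (Real.sqrt y : ℝ)) * (gauss ε a y *
      exp (-Real.pi * I * (-I * L * (ε - y * a)) ^ 2 / (I * y * L ^ 2))) /
      (2 * Real.pi * I * (I * y * L ^ 2)))
  refine hasSum_of_eq h (fun m => ?_) ?_
  · rw [← gauss_mul_exp_mul_term ε a hL hy m, jacobiTheta₂'_term]
    generalize jacobiTheta₂_term _ _ _ = t
    generalize exp _ = e
    field_simp
    ring_nf
    simp only [I_sq]
    ring
  · field_simp

lemma re_sq_sub_I_mul_div (ε : ℂ) (L : ℝ) (m : ℤ) :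
    ((ε - I * m / L) ^ 2).re = ε.re ^ 2 - (m / L - ε.im) ^ 2 := by
  have h : (ε - I * m / L) = ((ε.re : ℝ) : ℂ) + ((ε.im - m / L : ℝ) : ℂ) * I := by
    conv_lhs => rw [← Complex.re_add_im ε]
    push_cast
    ring
  rw [h, sq]
  simp
  ring

lemma norm_dualGauss_mul_exp (L : ℝ) (ε κ : ℂ) (m : ℤ) (y : ℝ) :
    ‖dualGauss L ε m y * exp (-Real.pi * κ / y)‖ =
      Real.exp (-(Real.pi * (κ.re - ((ε - I * m / L) ^ 2).re) / y)) := by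
  have h : (Real.pi * (ε - I * m / L) ^ 2 / y + -Real.pi * κ / y : ℂ) =
      ((Real.pi / y : ℝ) : ℂ) * ((ε - I * m / L) ^ 2 - κ) := by push_cast; ring
  rw [dualGauss, ← Complex.exp_add, Complex.norm_exp, h, Complex.re_ofReal_mul, Complex.sub_re]
  congr 1
  ring

lemma exp_neg_div_le {c y : ℝ} (hc : 0 < c) (hy : 0 < y) :
    Real.exp (-(c / y)) ≤ 2 * y ^ 2 / c ^ 2 := by
  have hx : 0 < c / y := by positivity
  have h := Real.pow_div_factorial_le_exp (c / y) hx.le 2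
  rw [Real.exp_neg]
  have h2 : 0 < (c / y) ^ 2 / (Nat.factorial 2 : ℕ) := by positivity
  calc (Real.exp (c / y))⁻¹ ≤ ((c / y) ^ 2 / (Nat.factorial 2 : ℕ))⁻¹ := inv_anti₀ h2 h
    _ = 2 * y ^ 2 / c ^ 2 := by
      simp only [Nat.factorial]
      field_simp
      norm_num

lemma summable_decay (ε κ : ℂ) {L : ℝ} (hL : 0 < L) :
    Summable fun m : ℤ => (1 + |(m : ℝ)|) / (κ.re - ((ε - I * m / L) ^ 2).re) ^ 2 := by
  set B : ℝ := 4 * L ^ 2 * (ε.im ^ 2 + |κ.re| + ε.re ^ 2) with hB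
  refine Summable.of_norm_bounded_eventually
    (g := fun m : ℤ => 32 * L ^ 4 * |(m : ℝ)| ^ (-(3 : ℝ))) ?_ ?_
  · exact (Real.summable_abs_int_rpow (by norm_num)).mul_left _
  · have hfin : ∀ᶠ m : ℤ in cofinite, max 1 B ≤ |(m : ℝ)| := by
      have := (tendsto_norm_cocompact_atTop (E := ℝ)).comp Int.tendsto_coe_cofinite
      exact this.eventually_ge_atTop _
    filter_upwards [hfin] with m hm
    have h1 : 1 ≤ |(m : ℝ)| := (le_max_left _ _).trans hm
    have h2 : B ≤ |(m : ℝ)| := (le_max_right _ _).trans hm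
    have hsq : |(m : ℝ)| ^ 2 = (m : ℝ) ^ 2 := sq_abs _
    set t := |(m : ℝ)| with ht
    have ht0 : 0 < t := by linarith
    have hδ : t ^ 2 / (4 * L ^ 2) ≤ κ.re - ((ε - I * m / L) ^ 2).re := by
      rw [re_sq_sub_I_mul_div]
      have h3 : t ^ 2 / (2 * L ^ 2) - ε.im ^ 2 ≤ (m / L - ε.im) ^ 2 := by
        have : (m / L - ε.im) ^ 2 - (t ^ 2 / (2 * L ^ 2) - ε.im ^ 2) =
            2 * (m / (2 * L) - ε.im) ^ 2 := by
          rw [hsq]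
          field_simp
          ring
        nlinarith [sq_nonneg (m / (2 * L) - ε.im)]
      have h4 : ε.im ^ 2 + |κ.re| + ε.re ^ 2 ≤ t ^ 2 / (4 * L ^ 2) := by
        rw [le_div_iff₀ (by positivity)]
        nlinarith
      have h5 : t ^ 2 / (2 * L ^ 2) = 2 * (t ^ 2 / (4 * L ^ 2)) := by
        field_simp
        norm_num
      have h6 := neg_abs_le κ.re
      linarith
    have hδ0 : 0 < t ^ 2 / (4 * L ^ 2) := by positivity
    have hrp : t ^ (-(3 : ℝ)) = 1 / t ^ 3 := by
      rw [Real.rpow_neg ht0.le, one_div]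
      norm_cast
    rw [Real.norm_of_nonneg (by positivity), hrp]
    calc (1 + t) / (κ.re - ((ε - I * m / L) ^ 2).re) ^ 2
        ≤ (2 * t) / (t ^ 2 / (4 * L ^ 2)) ^ 2 := by gcongr; linarith
      _ = 32 * L ^ 4 * (1 / t ^ 3) := by field_simp; norm_num

/-- Dual terms whose exponents have real part below that of `κ` are negligible with respect to
`e^{πκ/y}`, whatever the power of `y` in front of them. -/
lemma tendsto_dual_tail (ε κ : ℂ) {L : ℝ} (hL : 0 < L) (b : ℤ → ℝ → ℂ) (K : ℝ)
    (hb : ∀ m y, 0 < y → y ≤ 1 → ‖b m y‖ ≤ K * (1 + |(m : ℝ)|))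
    (hz : ∀ m, (∀ y, b m y = 0) ∨ 0 < κ.re - ((ε - I * m / L) ^ 2).re) :
    Tendsto (fun y : ℝ => ∑' m : ℤ, b m y / (y * (Real.sqrt y : ℝ)) *
      (dualGauss L ε m y * exp (-Real.pi * κ / y))) (𝓝[>] 0) (𝓝 0) := by
  set δ : ℤ → ℝ := fun m => κ.re - ((ε - I * m / L) ^ 2).re with hδ
  have hK : 0 ≤ K := by
    have := (norm_nonneg _).trans (hb 0 1 one_pos le_rfl)
    simpa using this
  have hs := ((summable_decay ε κ hL).mul_left (K * 2 / Real.pi ^ 2)).hasSum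
  set S := ∑' m : ℤ, K * 2 / Real.pi ^ 2 * ((1 + |(m : ℝ)|) / δ m ^ 2) with hS
  have hbound : ∀ᶠ y : ℝ in 𝓝[>] 0, ‖∑' m : ℤ, b m y / (y * (Real.sqrt y : ℝ)) *
      (dualGauss L ε m y * exp (-Real.pi * κ / y))‖ ≤ Real.sqrt y * S := by
    filter_upwards [Ioc_mem_nhdsGT (zero_lt_one (α := ℝ))] with y hy
    refine tsum_of_norm_bounded (hs.mul_left (Real.sqrt y)) fun m => ?_
    have hsy : 0 < Real.sqrt y := Real.sqrt_pos.2 hy.1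
    rcases hz m with h0 | h0
    · rw [h0, zero_div, zero_mul, norm_zero]
      positivity
    · rw [norm_mul, norm_dualGauss_mul_exp, norm_div, norm_mul, Complex.norm_real,
        Complex.norm_real, Real.norm_of_nonneg hy.1.le, Real.norm_of_nonneg hsy.le]
      have hδm : 0 < δ m := h0
      calc ‖b m y‖ / (y * Real.sqrt y) * Real.exp (-(Real.pi * δ m / y))
          ≤ K * (1 + |(m : ℝ)|) / (y * Real.sqrt y) * (2 * y ^ 2 / (Real.pi * δ m) ^ 2) := by
            have h1 := hy.1
            gcongr
            · exact hb m y hy.1 hy.2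
            · exact exp_neg_div_le (by positivity) hy.1
        _ = Real.sqrt y * (K * 2 / Real.pi ^ 2 * ((1 + |(m : ℝ)|) / δ m ^ 2)) := by
            have := Real.sq_sqrt hy.1.le
            have h1 := hy.1.ne'
            field_simp
            linear_combination (-K) * this
  refine squeeze_zero_norm' hbound ?_
  have h : Tendsto (fun y : ℝ => Real.sqrt y * S) (𝓝 0) (𝓝 0) := by
    simpa using (Real.continuous_sqrt.tendsto 0).mul_const S
  exact h.mono_left nhdsWithin_le_nhds

lemma norm_gauss_ofReal (ε : ℂ) (x y : ℝ) :
    ‖gauss ε x y‖ = Real.exp (2 * Real.pi * ε.re * x - Real.pi * y * x ^ 2) := by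
  rw [gauss, Complex.norm_exp]
  congr 1
  have h : (2 * Real.pi * ε * x - Real.pi * y * x ^ 2 : ℂ) =
      ((2 * Real.pi * x : ℝ) : ℂ) * ε - ((Real.pi * y * x ^ 2 : ℝ) : ℂ) := by push_cast; ring
  rw [h, Complex.sub_re, Complex.re_ofReal_mul, Complex.ofReal_re]
  ring

lemma summable_int_mul_gauss (ε a : ℂ) {L y : ℝ} (hL : 0 < L) (hy : 0 < y) :
    Summable fun j : ℤ => (j : ℂ) * gauss ε (a + L * j) y :=
  (hasSum_int_mul_gauss_theta ε a hL hy).summable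

lemma summable_nat_mul_gauss_add (ε a : ℂ) {L y : ℝ} (hL : 0 < L) (hy : 0 < y) :
    Summable fun j : ℕ => (j : ℂ) * gauss ε (a + L * j) y := by
  have h := (summable_int_mul_gauss ε a hL hy).comp_injective Nat.cast_injective
  exact h.congr fun j => by simp

lemma summable_nat_mul_gauss_sub (ε a : ℂ) {L y : ℝ} (hL : 0 < L) (hy : 0 < y) :
    Summable fun j : ℕ => (j : ℂ) * gauss ε (a - L * j) y := by
  have h := ((summable_int_mul_gauss ε a hL hy).comp_injective
    (neg_injective.comp Nat.cast_injective : Function.Injective fun j : ℕ => -(j : ℤ))).neg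
  refine h.congr fun j => ?_
  simp only [Function.comp_apply]
  push_cast
  rw [show a + (L : ℂ) * -(j : ℂ) = a - L * j by ring]
  ring

lemma summable_gauss_sub (ε a : ℂ) {L y : ℝ} (hL : 0 < L) (hy : 0 < y) :
    Summable fun j : ℕ => gauss ε (a - L * j) y := by
  have h := ((hasSum_gauss_theta ε a hL hy).summable.comp_injective
    (neg_injective.comp Nat.cast_injective : Function.Injective fun j : ℕ => -(j : ℤ)))
  refine h.congr fun j => ?_
  simp only [Function.comp_apply]
  push_cast
  rw [show a + (L : ℂ) * -(j : ℂ) = a - L * j by ring]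

/-- The weighted one-sided Gaussian sum `∑_{j ≥ 0} j e^{2πεx - πyx²}`, `x = a - Lj`. -/
noncomputable def halfSum (ε : ℂ) (L : ℝ) (a : ℂ) (y : ℝ) : ℂ :=
  ∑' j : ℕ, (j : ℂ) * gauss ε (a - L * j) y

lemma halfSum_eq_sub (ε a : ℂ) {L y : ℝ} (hL : 0 < L) (hy : 0 < y) :
    halfSum ε L a y = ∑' j : ℕ, (j : ℂ) * gauss ε (a + L * j) y -
      ∑' j : ℤ, (j : ℂ) * gauss ε (a + L * j) y := by
  have h1 := (summable_nat_mul_gauss_add ε a hL hy).hasSum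
  have h2 := (summable_nat_mul_gauss_sub ε a hL hy).hasSum.neg
  have h := HasSum.of_nat_of_neg (f := fun j : ℤ => (j : ℂ) * gauss ε (a + L * j) y)
    (hasSum_of_eq h1 (fun j => by simp) rfl)
    (hasSum_of_eq h2 (fun j => by
      push_cast
      rw [show a + (L : ℂ) * -(j : ℂ) = a - L * j by ring]
      ring) rfl)
  rw [h.tsum_eq, halfSum]
  simp

lemma tendsto_gauss (ε x : ℂ) :
    Tendsto (gauss ε x) (𝓝[>] 0) (𝓝 (exp (2 * Real.pi * ε * x))) := by
  have h : Continuous (gauss ε x) := by unfold gauss; fun_prop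
  have h0 : gauss ε x 0 = exp (2 * Real.pi * ε * x) := by simp [gauss]
  rw [← h0]
  exact (h.tendsto 0).mono_left nhdsWithin_le_nhds

lemma geometric_eq_sinh (z : ℂ) (hz : sinh z ≠ 0) :
    exp (2 * z) / (1 - exp (2 * z)) ^ 2 = 1 / (4 * sinh z ^ 2) := by
  have h2 : exp (2 * z) = exp z ^ 2 := by rw [← Complex.exp_nat_mul]; norm_num
  have h3 : exp z * exp (-z) = 1 := by rw [← Complex.exp_add]; simp
  have h4 : 1 - exp (2 * z) = -(2 * exp z * sinh z) := by
    rw [Complex.sinh, h2]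
    linear_combination -h3
  rw [h4, h2]
  have := Complex.exp_ne_zero z
  field_simp
  norm_num

lemma re_eq_zero_of_sinh_eq_zero {z : ℂ} (h : sinh z = 0) : z.re = 0 := by
  rw [Complex.sinh, div_eq_zero_iff, sub_eq_zero] at h
  have h1 := congrArg norm (h.resolve_right two_ne_zero)
  rw [Complex.norm_exp, Complex.norm_exp, Real.exp_eq_exp, Complex.neg_re] at h1
  linarith

lemma tendsto_tsum_nat_mul_gauss (ε : ℂ) (a c : ℝ) (hc : ε.re * c < 0) :
    Tendsto (fun y : ℝ => ∑' j : ℕ, (j : ℂ) * gauss ε (a + c * j) y) (𝓝[>] 0)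
      (𝓝 (exp (2 * Real.pi * ε * a) / (4 * sinh (Real.pi * ε * c) ^ 2))) := by
  have hre : (Real.pi * ε * c : ℂ).re = Real.pi * (ε.re * c) := by
    rw [mul_assoc, Complex.re_ofReal_mul, Complex.re_mul_ofReal]
  have hs : sinh (Real.pi * ε * c) ≠ 0 := fun h => by
    have := re_eq_zero_of_sinh_eq_zero h
    rw [hre] at this
    have := Real.pi_pos
    nlinarith
  have hnorm : ‖exp (2 * (Real.pi * ε * c))‖ < 1 := by
    have h2 : (2 * (Real.pi * ε * c) : ℂ).re = 2 * (Real.pi * (ε.re * c)) := by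
      rw [← hre]; simp
    rw [Complex.norm_exp, h2, Real.exp_lt_one_iff]
    have := Real.pi_pos
    nlinarith
  have hg := (hasSum_coe_mul_geometric_of_norm_lt_one hnorm).mul_left (exp (2 * Real.pi * ε * a))
  have hval : exp (2 * Real.pi * ε * a) / (4 * sinh (Real.pi * ε * c) ^ 2) =
      ∑' j : ℕ, exp (2 * Real.pi * ε * a) * ((j : ℂ) * exp (2 * (Real.pi * ε * c)) ^ j) := by
    rw [hg.tsum_eq, geometric_eq_sinh _ hs]
    ring
  rw [hval]
  refine tendsto_tsum_of_dominated_convergence hg.summable.norm (fun j => ?_) ?_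
  · have := (tendsto_gauss ε (a + c * j)).const_mul (j : ℂ)
    convert this using 2
    rw [← Complex.exp_nat_mul, mul_left_comm, ← Complex.exp_add]
    ring_nf
  · filter_upwards [self_mem_nhdsWithin] with y hy j
    have hy0 : 0 < y := hy
    have hx : ((a : ℂ) + c * j) = ((a + c * j : ℝ) : ℂ) := by push_cast; ring
    rw [← Complex.exp_nat_mul, mul_left_comm, ← Complex.exp_add, norm_mul, norm_mul, hx,
      norm_gauss_ofReal, Complex.norm_exp]
    refine mul_le_mul_of_nonneg_left (Real.exp_le_exp.2 ?_) (norm_nonneg _)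
    have h3 : (2 * Real.pi * ε * a + j * (2 * (Real.pi * ε * c)) : ℂ) =
        ((2 * Real.pi * (a + c * j) : ℝ) : ℂ) * ε := by push_cast; ring
    rw [h3, Complex.re_ofReal_mul]
    have := Real.pi_pos
    have h4 : 0 ≤ Real.pi * y * (a + c * j) ^ 2 := by positivity
    linarith

/-- The alternating sum of a function over the points `L/2 (n ± ρ ± κ)`. -/
noncomputable def altSum (L ρ κ n : ℝ) (F : ℝ → ℂ) : ℂ :=
  F (L / 2 * (n + ρ + κ)) - F (L / 2 * (n + ρ - κ)) - F (L / 2 * (n - ρ + κ))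
    + F (L / 2 * (n - ρ - κ))

lemma tendsto_altSum {L ρ κ n : ℝ} {F : ℝ → ℝ → ℂ} {G : ℝ → ℂ} {l : Filter ℝ}
    (h : ∀ a, Tendsto (F a) l (𝓝 (G a))) :
    Tendsto (fun y => altSum L ρ κ n fun a => F a y) l (𝓝 (altSum L ρ κ n G)) :=
  (((h _).sub (h _)).sub (h _)).add (h _)

lemma hasSum_altSum {ι : Type*} {L ρ κ n : ℝ} {F : ℝ → ι → ℂ} {G : ℝ → ℂ} (h : ∀ a, HasSum (F a) (G a)) :
    HasSum (fun m => altSum L ρ κ n fun a => F a m) (altSum L ρ κ n G) :=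
  (((h _).sub (h _)).sub (h _)).add (h _)

lemma norm_altSum_le {L ρ κ n : ℝ} {F : ℝ → ℂ} {B : ℝ → ℝ} (h : ∀ a, ‖F a‖ ≤ B a) :
    ‖altSum L ρ κ n F‖ ≤ B (L / 2 * (n + ρ + κ)) + B (L / 2 * (n + ρ - κ)) +
      B (L / 2 * (n - ρ + κ)) + B (L / 2 * (n - ρ - κ)) := by
  refine (norm_add_le _ _).trans (add_le_add ((norm_sub_le _ _).trans (add_le_add
    ((norm_sub_le _ _).trans (add_le_add (h _) (h _))) (h _))) (h _))

lemma altSum_exp (L ρ κ n : ℝ) (c u : ℂ) (hu : c * L = 2 * u) :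
    altSum L ρ κ n (fun a => exp (c * a)) = 4 * (exp (u * n) * (sinh (u * ρ) * sinh (u * κ))) := by
  have key : ∀ b : ℂ, c * (L / 2 * b) = u * b := fun b => by linear_combination b / 2 * hu
  simp only [altSum, Complex.ofReal_mul, Complex.ofReal_add, Complex.ofReal_sub,
    Complex.ofReal_div, Complex.ofReal_ofNat, key]
  simp only [Complex.sinh, mul_add, sub_eq_add_neg, Complex.exp_add, mul_neg]
  ring

lemma altSum_mul_exp (L ρ κ n : ℝ) (c u : ℂ) (hu : c * L = 2 * u) :
    altSum L ρ κ n (fun a => a * exp (c * a)) = 2 * L * (exp (u * n) *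
      (n * (sinh (u * ρ) * sinh (u * κ)) + ρ * (cosh (u * ρ) * sinh (u * κ)) +
        κ * (sinh (u * ρ) * cosh (u * κ)))) := by
  have key : ∀ b : ℂ, c * (L / 2 * b) = u * b := fun b => by linear_combination b / 2 * hu
  simp only [altSum, Complex.ofReal_mul, Complex.ofReal_add, Complex.ofReal_sub,
    Complex.ofReal_div, Complex.ofReal_ofNat, key]
  simp only [Complex.sinh, Complex.cosh, mul_add, sub_eq_add_neg, Complex.exp_add, mul_neg]
  ring

/-- The coefficient of the `m`-th dual Gaussian in an alternating sum of one-sided sums. -/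
noncomputable def dualCoeff (ε : ℂ) (L ρ κ n : ℝ) (m : ℤ) (y : ℝ) : ℂ :=
  (y * altSum L ρ κ n (fun a => a * exp (2 * Real.pi * I * m / L * a)) -
    (ε - I * m / L) * altSum L ρ κ n (fun a => exp (2 * Real.pi * I * m / L * a))) / L ^ 2

lemma norm_exp_two_pi_I_mul (L : ℝ) (m : ℤ) (a : ℝ) :
    ‖exp (2 * Real.pi * I * m / L * a)‖ = 1 := by
  have h : (2 * Real.pi * I * m / L * a : ℂ) = ((2 * Real.pi * m / L * a : ℝ) : ℂ) * I := by
    push_cast; ring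
  rw [h, Complex.norm_exp_ofReal_mul_I]

lemma exists_norm_dualCoeff_le (ε : ℂ) {L : ℝ} (hL : 0 < L) (ρ κ n : ℝ) :
    ∃ K : ℝ, ∀ m y, 0 < y → y ≤ 1 → ‖dualCoeff ε L ρ κ n m y‖ ≤ K * (1 + |(m : ℝ)|) := by
  set C := |L / 2 * (n + ρ + κ)| + |L / 2 * (n + ρ - κ)| + |L / 2 * (n - ρ + κ)|
    + |L / 2 * (n - ρ - κ)| with hC
  have hC0 : 0 ≤ C := by positivity
  refine ⟨(C + 4 * ‖ε‖ + 4 / L) / L ^ 2, fun m y hy hy1 => ?_⟩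
  have hR : ‖altSum L ρ κ n (fun a => a * exp (2 * Real.pi * I * m / L * a))‖ ≤ C :=
    norm_altSum_le (B := fun a => |a|) fun a => by
      rw [norm_mul, norm_exp_two_pi_I_mul, mul_one, Complex.norm_real, Real.norm_eq_abs]
  have hQ : ‖altSum L ρ κ n (fun a => exp (2 * Real.pi * I * m / L * a))‖ ≤ 1 + 1 + 1 + 1 :=
    norm_altSum_le (B := fun _ => 1) fun a => (norm_exp_two_pi_I_mul L m a).le
  have hw : ‖ε - I * m / L‖ ≤ ‖ε‖ + |(m : ℝ)| / L := by
    refine (norm_sub_le _ _).trans (add_le_add le_rfl ?_)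
    rw [norm_div, norm_mul, Complex.norm_I, one_mul, Complex.norm_real, Complex.norm_intCast,
      Real.norm_of_nonneg hL.le]
  rw [dualCoeff, norm_div, norm_pow, Complex.norm_real, Real.norm_of_nonneg hL.le, div_mul_eq_mul_div]
  refine div_le_div_of_nonneg_right ?_ (by positivity)
  refine (norm_sub_le _ _).trans ?_
  rw [norm_mul, norm_mul, Complex.norm_real, Real.norm_of_nonneg hy.le]
  have h1 : y * ‖altSum L ρ κ n (fun a => a * exp (2 * Real.pi * I * m / L * a))‖ ≤ 1 * C := by
    gcongr
  have h2 : ‖ε - I * m / L‖ * ‖altSum L ρ κ n (fun a => exp (2 * Real.pi * I * m / L * a))‖ ≤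
      (‖ε‖ + |(m : ℝ)| / L) * (1 + 1 + 1 + 1) := by gcongr
  have h3 : 0 ≤ |(m : ℝ)| * (C + 4 * ‖ε‖) + 4 / L := by positivity
  calc _ ≤ 1 * C + (‖ε‖ + |(m : ℝ)| / L) * (1 + 1 + 1 + 1) := add_le_add h1 h2
    _ ≤ 1 * C + (‖ε‖ + |(m : ℝ)| / L) * (1 + 1 + 1 + 1) +
        (|(m : ℝ)| * (C + 4 * ‖ε‖) + 4 / L) := le_add_of_nonneg_right h3
    _ = _ := by ring

lemma hasSum_altSum_dual (ε : ℂ) {L y : ℝ} (hL : 0 < L) (hy : 0 < y) (ρ κ n : ℝ) (c : ℂ) :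
    HasSum (fun m : ℤ => dualCoeff ε L ρ κ n m y / (y * (Real.sqrt y : ℝ)) *
        (dualGauss L ε m y * c))
      (-altSum L ρ κ n (fun a => ∑' j : ℤ, (j : ℂ) * gauss ε (a + L * j) y) * c) := by
  have h := ((hasSum_altSum (L := L) (ρ := ρ) (κ := κ) (n := n)
    fun a => hasSum_int_mul_gauss_dual ε (a : ℂ) hL hy).neg).mul_right c
  refine hasSum_of_eq h (fun m => ?_) rfl
  have hexp : ∀ a : ℂ, exp (2 * Real.pi * I * m * a / L) = exp (2 * Real.pi * I * m / L * a) :=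
    fun a => by congr 1; ring
  have hL' : (L : ℂ) ≠ 0 := by exact_mod_cast hL.ne'
  simp only [altSum, dualCoeff, hexp]
  generalize dualGauss L ε m y = g
  generalize (ε - I * m / L) = w
  rw [← div_div]
  simp only [sub_div, sub_mul, mul_add, mul_sub, mul_div_assoc]
  ring

/-- The alternating combination of one-sided Gaussian sums that is the numerator of the
regularised character of a singlet module, up to minimal model characters. -/
noncomputable def imNum (ε : ℂ) (L ρ κ n y : ℝ) : ℂ :=
  altSum L ρ κ n fun a => halfSum ε L a y

lemma imNum_eq_sub (ε : ℂ) {L y : ℝ} (hL : 0 < L) (hy : 0 < y) (ρ κ n : ℝ) :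
    imNum ε L ρ κ n y = altSum L ρ κ n (fun a => ∑' j : ℕ, (j : ℂ) * gauss ε (a + L * j) y) +
      -altSum L ρ κ n (fun a => ∑' j : ℤ, (j : ℂ) * gauss ε (a + L * j) y) := by
  simp only [imNum, halfSum_eq_sub ε _ hL hy, altSum]
  ring

/-- The value at `y = 0` of `imNum`, by regularised summation. -/
noncomputable def imLimit (u : ℂ) (ρ κ n : ℝ) : ℂ :=
  exp (u * n) * (sinh (u * ρ) * sinh (u * κ)) / sinh u ^ 2

lemma altSum_exp_div (ε : ℂ) (L ρ κ n : ℝ) :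
    altSum L ρ κ n (fun a => exp (2 * Real.pi * ε * a) / (4 * sinh (Real.pi * ε * L) ^ 2)) =
      imLimit (Real.pi * ε * L) ρ κ n := by
  have h := altSum_exp L ρ κ n (2 * Real.pi * ε) (Real.pi * ε * L) (by ring)
  have h2 : altSum L ρ κ n
      (fun a => exp (2 * Real.pi * ε * a) / (4 * sinh (Real.pi * ε * L) ^ 2)) =
      altSum L ρ κ n (fun a => exp (2 * Real.pi * ε * a)) / (4 * sinh (Real.pi * ε * L) ^ 2) := by
    simp only [altSum]
    ring
  rw [h2, h, imLimit, mul_div_mul_left _ _ (by norm_num : (4 : ℂ) ≠ 0)]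

lemma tendsto_imNum_of_re_pos {ε : ℂ} (hε : 0 < ε.re) {L : ℝ} (hL : 0 < L) (ρ κ n : ℝ) :
    Tendsto (imNum ε L ρ κ n) (𝓝[>] 0) (𝓝 (imLimit (Real.pi * ε * L) ρ κ n)) := by
  rw [← altSum_exp_div]
  refine tendsto_altSum (F := fun a y => halfSum ε L a y) fun a => ?_
  have h := tendsto_tsum_nat_mul_gauss ε a (-L) (by nlinarith)
  simp only [Complex.ofReal_neg, neg_mul, mul_neg, ← sub_eq_add_neg, Complex.sinh_neg,
    neg_sq] at h
  exact h

lemma tendsto_altSum_nat_of_re_neg {ε : ℂ} (hε : ε.re < 0) {L : ℝ} (hL : 0 < L) (ρ κ n : ℝ) :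
    Tendsto (fun y : ℝ => altSum L ρ κ n
        (fun a => ∑' j : ℕ, (j : ℂ) * gauss ε (a + L * j) y)) (𝓝[>] 0)
      (𝓝 (imLimit (Real.pi * ε * L) ρ κ n)) := by
  rw [← altSum_exp_div]
  exact tendsto_altSum (F := fun (a y : ℝ) => ∑' j : ℕ, (j : ℂ) * gauss ε (a + L * j) y)
    fun a => tendsto_tsum_nat_mul_gauss ε a L (by nlinarith)

lemma tendsto_imNum_of_re_neg {ε : ℂ} (hε : ε.re < 0) {L : ℝ} (hL : 0 < L) (ρ κ n : ℝ)
    (hz : ∀ m, (∀ y, dualCoeff ε L ρ κ n m y = 0) ∨ ((ε - I * m / L) ^ 2).re < 0) :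
    Tendsto (imNum ε L ρ κ n) (𝓝[>] 0) (𝓝 (imLimit (Real.pi * ε * L) ρ κ n)) := by
  obtain ⟨K, hK⟩ := exists_norm_dualCoeff_le ε hL ρ κ n
  have ht := tendsto_dual_tail ε 0 hL _ K hK (fun m => (hz m).imp_right fun h => by
    rw [Complex.zero_re]; linarith)
  have h := (tendsto_altSum_nat_of_re_neg hε hL ρ κ n).add ht
  rw [add_zero] at h
  refine h.congr' ?_
  filter_upwards [self_mem_nhdsWithin] with y hy
  rw [(hasSum_altSum_dual ε hL hy ρ κ n _).tsum_eq, imNum_eq_sub ε hL hy]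
  simp

lemma tendsto_exp_neg_div {κ : ℂ} (hκ : 0 < κ.re) :
    Tendsto (fun y : ℝ => exp (-Real.pi * κ / y)) (𝓝[>] 0) (𝓝 0) := by
  rw [tendsto_zero_iff_norm_tendsto_zero]
  have h : ∀ y : ℝ, ‖exp (-Real.pi * κ / y)‖ = Real.exp (-(Real.pi * κ.re * y⁻¹)) := fun y => by
    have : (-Real.pi * κ / y : ℂ) = ((-(Real.pi * y⁻¹) : ℝ) : ℂ) * κ := by push_cast; ring
    rw [Complex.norm_exp, this, Complex.re_ofReal_mul]
    congr 1
    ring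
  simp only [h]
  exact Real.tendsto_exp_neg_atTop_nhds_zero.comp
    (tendsto_inv_nhdsGT_zero.const_mul_atTop (by positivity))

/-- To the left of the wall, one dual Gaussian dominates. -/
lemma tendsto_imNum_sub_leading {ε : ℂ} (hε : ε.re < 0) {L : ℝ} (hL : 0 < L) (ρ κ n : ℝ) (m₀ : ℤ)
    (hpos : 0 < ((ε - I * m₀ / L) ^ 2).re)
    (hz : ∀ m, m ≠ m₀ → (∀ y, dualCoeff ε L ρ κ n m y = 0) ∨
      ((ε - I * m / L) ^ 2).re < ((ε - I * m₀ / L) ^ 2).re) :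
    Tendsto (fun y : ℝ => imNum ε L ρ κ n y * exp (-Real.pi * (ε - I * m₀ / L) ^ 2 / y) -
      dualCoeff ε L ρ κ n m₀ y / (y * (Real.sqrt y : ℝ))) (𝓝[>] 0) (𝓝 0) := by
  obtain ⟨K, hK⟩ := exists_norm_dualCoeff_le ε hL ρ κ n
  set κ₀ := (ε - I * m₀ / L) ^ 2 with hκ₀
  set b : ℤ → ℝ → ℂ := fun m y => if m = m₀ then 0 else dualCoeff ε L ρ κ n m y with hb
  have ht := tendsto_dual_tail ε κ₀ hL b K (fun m y hy hy1 => by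
    by_cases hm : m = m₀
    · simp only [hb, hm, if_true, norm_zero]
      exact (norm_nonneg _).trans (hK m₀ y hy hy1)
    · simp only [hb, hm, if_false]
      exact hK m y hy hy1) (fun m => by
    by_cases hm : m = m₀
    · left; simp [hb, hm]
    · simp only [hb, hm, if_false]
      exact (hz m hm).imp_right fun h => by linarith)
  have hΦ := tendsto_exp_neg_div hpos
  have h := ((tendsto_altSum_nat_of_re_neg hε hL ρ κ n).mul hΦ).add ht
  rw [mul_zero, add_zero] at h
  refine h.congr' ?_
  filter_upwards [self_mem_nhdsWithin] with y hy
  have hy0 : 0 < y := hy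
  have hs := hasSum_altSum_dual ε hL hy ρ κ n (exp (-Real.pi * κ₀ / y))
  have hsplit := hs.summable.tsum_eq_add_tsum_ite m₀
  have hlead : dualGauss L ε m₀ y * exp (-Real.pi * κ₀ / y) = 1 := by
    rw [dualGauss, ← Complex.exp_add, ← hκ₀]
    simp [neg_div]
  rw [hs.tsum_eq, hlead, mul_one] at hsplit
  have hcongr : ∑' m : ℤ, b m y / (y * (Real.sqrt y : ℝ)) *
      (dualGauss L ε m y * exp (-Real.pi * κ₀ / y)) =
      ∑' m : ℤ, if m = m₀ then 0 else dualCoeff ε L ρ κ n m y / (y * (Real.sqrt y : ℝ)) *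
      (dualGauss L ε m y * exp (-Real.pi * κ₀ / y)) := tsum_congr fun m => by
    by_cases hm : m = m₀ <;> simp [hb, hm]
  rw [hcongr, imNum_eq_sub ε hL hy, add_mul]
  linear_combination -hsplit

lemma hasSum_imNum (ε : ℂ) {L y : ℝ} (hL : 0 < L) (hy : 0 < y) (ρ κ n : ℝ) :
    HasSum (fun k : ℕ => ((k : ℂ) + 1) *
      altSum L ρ κ n (fun a => gauss ε (a - L * (k + 1)) y)) (imNum ε L ρ κ n y) := by
  have h := (hasSum_nat_add_iff' 1).2 (hasSum_altSum (L := L) (ρ := ρ) (κ := κ) (n := n)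
    fun a => (summable_nat_mul_gauss_sub ε (a : ℂ) hL hy).hasSum)
  refine hasSum_of_eq h (fun k => ?_) ?_
  · simp only [altSum, Nat.cast_add, Nat.cast_one]
    ring
  · simp [imNum, halfSum, altSum]

lemma hasSum_abel {h : ℕ → ℂ} (h0 : Summable h) (h1 : Summable fun k : ℕ => (k : ℂ) * h k) :
    HasSum (fun k : ℕ => ((k : ℂ) + 1) * (h k - h (k + 1))) (∑' k, h k) := by
  have hs := (hasSum_nat_add_iff' 1).2 h1.hasSum
  refine hasSum_of_eq ((h1.hasSum.sub hs).add h0.hasSum) (fun k => ?_) ?_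
  · push_cast
    ring
  · simp

lemma altSum_comm (L ρ κ n : ℝ) (F : ℝ → ℂ) : altSum L ρ κ n F = altSum L κ ρ n F := by
  simp only [altSum]
  rw [show n + ρ + κ = n + κ + ρ by ring, show n + ρ - κ = n - κ + ρ by ring,
    show n - ρ + κ = n + κ - ρ by ring, show n - ρ - κ = n - κ - ρ by ring]
  ring

lemma imNum_comm (ε : ℂ) (L ρ κ n y : ℝ) : imNum ε L ρ κ n y = imNum ε L κ ρ n y :=
  altSum_comm _ _ _ _ _

lemma imNum_one_left (ε : ℂ) {L y : ℝ} (hL : 0 < L) (hy : 0 < y) (κ n : ℝ) :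
    imNum ε L 1 κ n y = ∑' k : ℕ, (gauss ε ((L / 2 * (n - 2 * k - 1 + κ) : ℝ)) y -
      gauss ε ((L / 2 * (n - 2 * k - 1 - κ) : ℝ)) y) := by
  have key : ∀ (t : ℝ) (k : ℕ), (((L / 2 * (n - 2 * k - 1 + t) : ℝ)) : ℂ) =
      ((L / 2 * (n - 1 + t) : ℝ) : ℂ) - L * k := fun t k => by push_cast; ring
  simp only [sub_eq_add_neg _ κ, key]
  refine (hasSum_imNum ε hL hy 1 κ n).unique ?_
  refine hasSum_of_eq (hasSum_abel ((summable_gauss_sub ε _ hL hy).sub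
    (summable_gauss_sub ε _ hL hy)) ?_) (fun k => ?_) rfl
  · simp only [mul_sub]
    exact (summable_nat_mul_gauss_sub ε _ hL hy).sub (summable_nat_mul_gauss_sub ε _ hL hy)
  · simp only [altSum]
    congr 1
    push_cast
    have e1 : ∀ t : ℂ, (L / 2 * (n + 1 + t) - L * (k + 1) : ℂ) = L / 2 * (n - 1 + t) - L * k :=
      fun t => by ring
    simp only [sub_eq_add_neg _ (κ : ℂ), e1]
    ring

lemma imNum_one_one (ε : ℂ) {L y : ℝ} (hL : 0 < L) (hy : 0 < y) (n : ℝ) :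
    imNum ε L 1 1 n y = gauss ε ((L / 2 * n : ℝ)) y := by
  have hs := (summable_gauss_sub ε ((L / 2 * n : ℝ) : ℂ) hL hy).hasSum
  have h := hs.sub ((hasSum_nat_add_iff' 1).2 hs)
  rw [imNum_one_left ε hL hy, HasSum.tsum_eq (hasSum_of_eq h (fun k => ?_) rfl)]
  · simp
  · congr 2 <;> push_cast <;> ring

lemma alphaFull_pos {pp pm : ℕ} (hpp : 0 < pp) (hpm : 0 < pm) : 0 < alphaFull pp pm :=
  Real.sqrt_pos.2 (by positivity)

lemma alphaPlus_eq {pp pm : ℕ} (hpp : 0 < pp) : alphaPlus pp pm = alphaFull pp pm / pp := by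
  have h : (2 * pm / pp : ℝ) = 2 * pp * pm / (pp : ℝ) ^ 2 := by field_simp
  rw [alphaPlus, alphaFull, h, Real.sqrt_div' _ (by positivity), Real.sqrt_sq (by positivity)]

lemma alphaMinus_eq {pp pm : ℕ} (hpm : 0 < pm) : alphaMinus pp pm = -(alphaFull pp pm / pm) := by
  have h : (2 * pp / pm : ℝ) = 2 * pp * pm / (pm : ℝ) ^ 2 := by field_simp
  rw [alphaMinus, alphaFull, h, Real.sqrt_div' _ (by positivity), Real.sqrt_sq (by positivity)]

lemma fockCh_I_mul (pp pm : ℕ) (ε lam : ℂ) (y : ℝ) :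
    fockCh pp pm ε lam (I * y) =
      gauss ε (lam - alphaZero pp pm / 2) y / ModularForm.eta (I * y) := by
  rw [fockCh, gauss, ← Complex.exp_add]
  congr 2
  linear_combination (Real.pi * y * (lam - alphaZero pp pm / 2) ^ 2 : ℂ) * I_sq

lemma fockIdxCh_I_mul {pp pm : ℕ} (hpp : 0 < pp) (hpm : 0 < pm) (ε : ℂ) (r s n : ℤ) (y : ℝ)
    {t : ℝ} (ht : (n : ℝ) - r / pp + s / pm = t) :
    fockIdxCh pp pm ε r s n (I * y) =
      gauss ε ((alphaFull pp pm / 2 * t : ℝ)) y / ModularForm.eta (I * y) := by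
  rw [fockIdxCh, fockCh_I_mul, ← ht, alphaIdx, alphaZero, alphaPlus_eq hpp, alphaMinus_eq hpm]
  congr 2
  push_cast
  ring

/-- The numerator of the minimal model character. -/
noncomputable def virNum (L ρ κ y : ℝ) : ℂ :=
  ∑' k : ℤ, (gauss 0 ((L / 2 * (2 * k - ρ + κ) : ℝ)) y - gauss 0 ((L / 2 * (2 * k + ρ + κ) : ℝ)) y)

lemma tendsto_virNum {L : ℝ} (hL : 0 < L) (ρ κ : ℝ) :
    Tendsto (virNum L ρ κ) (𝓝[>] 0) (𝓝 0) := by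
  set a₁ : ℝ := L / 2 * (-ρ + κ) with ha₁
  set a₂ : ℝ := L / 2 * (ρ + κ) with ha₂
  set b : ℤ → ℝ → ℂ := fun m y => y / L *
    (exp (2 * Real.pi * I * m / L * a₁) - exp (2 * Real.pi * I * m / L * a₂)) with hb
  have ht := tendsto_dual_tail 0 0 hL b (2 / L) (fun m y hy hy1 => ?_) (fun m => ?_)
  · refine ht.congr' ?_
    filter_upwards [self_mem_nhdsWithin] with y hy
    have hy0 : 0 < y := hy
    have hL' : (L : ℂ) ≠ 0 := by exact_mod_cast hL.ne'
    have hy' : (y : ℂ) ≠ 0 := by exact_mod_cast hy0.ne'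
    have hs : ((Real.sqrt y : ℝ) : ℂ) ≠ 0 := by exact_mod_cast (Real.sqrt_pos.2 hy0).ne'
    have hv : virNum L ρ κ y = ∑' k : ℤ, gauss 0 (a₁ + L * k) y
        - ∑' k : ℤ, gauss 0 (a₂ + L * k) y := by
      rw [← (hasSum_gauss_theta 0 a₁ hL hy0).summable.tsum_sub
        (hasSum_gauss_theta 0 a₂ hL hy0).summable, virNum]
      refine tsum_congr fun k => ?_
      congr 2 <;> simp only [ha₁, ha₂] <;> push_cast <;> ring
    rw [hv]
    have h := (hasSum_gauss_dual 0 (a₁ : ℂ) hL hy0).sub (hasSum_gauss_dual 0 (a₂ : ℂ) hL hy0)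
    refine HasSum.tsum_eq (hasSum_of_eq h (fun m => ?_) rfl)
    have hexp : ∀ a : ℂ, exp (2 * Real.pi * I * m * a / L) = exp (2 * Real.pi * I * m / L * a) :=
      fun a => by congr 1; ring
    simp only [hb, hexp, mul_zero, zero_div, Complex.exp_zero, mul_one]
    field_simp
  · have h2 : ‖exp (2 * Real.pi * I * m / L * a₁) - exp (2 * Real.pi * I * m / L * a₂)‖ ≤ 1 + 1 :=
      (norm_sub_le _ _).trans (add_le_add (norm_exp_two_pi_I_mul L m a₁).le
        (norm_exp_two_pi_I_mul L m a₂).le)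
    simp only [hb]
    rw [norm_mul, norm_div, Complex.norm_real, Complex.norm_real, Real.norm_of_nonneg hy.le,
      Real.norm_of_nonneg hL.le]
    calc y / L * _ ≤ 1 / L * (1 + 1) := by gcongr
      _ = 2 / L * 1 := by ring
      _ ≤ 2 / L * (1 + |(m : ℝ)|) := by
        gcongr
        linarith [abs_nonneg (m : ℝ)]
  · rcases eq_or_ne m 0 with hm | hm
    · left
      intro y
      simp [hb, hm]
    · right
      rw [re_sq_sub_I_mul_div]
      have : (0 : ℝ) < (m / L) ^ 2 := by
        have : (m : ℝ) ≠ 0 := by exact_mod_cast hm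
        positivity
      simpa using this

lemma virCh_I_mul {pp pm : ℕ} (hpp : 0 < pp) (hpm : 0 < pm) (r s : ℤ) (y : ℝ) :
    virCh pp pm r s (I * y) =
      virNum (alphaFull pp pm) (r / pp) (s / pm) y / ModularForm.eta (I * y) := by
  have hpp' : (pp : ℝ) ≠ 0 := by positivity
  rw [virCh, virNum, ← tsum_div_const]
  refine tsum_congr fun k => ?_
  rw [fockIdxCh_I_mul (t := 2 * k - r / pp + s / pm) hpp hpm,
    fockIdxCh_I_mul (t := 2 * k + r / pp + s / pm) hpp hpm, sub_div]
  · push_cast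
    field_simp
    ring
  · push_cast
    ring

lemma exists_imCh_I_mul {pp pm : ℕ} (hpp : 0 < pp) (hpm : 0 < pm) (ε : ℂ) (r s n : ℤ) :
    ∃ V : ℝ → ℂ, Tendsto V (𝓝[>] 0) (𝓝 0) ∧ ∀ y : ℝ, 0 < y →
      imCh pp pm ε r s n (I * y) =
        (V y + imNum ε (alphaFull pp pm) (r / pp) (s / pm) n y) / ModularForm.eta (I * y) := by
  have hpp' : (pp : ℝ) ≠ 0 := by positivity
  have hpm' : (pm : ℝ) ≠ 0 := by positivity
  have hL := alphaFull_pos hpp hpm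
  by_cases hr : r = pp
  · refine ⟨fun _ => 0, tendsto_const_nhds, fun y hy => ?_⟩
    have hr1 : ((r : ℝ) / pp) = 1 := by rw [hr]; push_cast; field_simp
    rw [hr1, zero_add]
    by_cases hs : s = pm
    · have hs1 : ((s : ℝ) / pm) = 1 := by rw [hs]; push_cast; field_simp
      rw [hs1, imCh, if_pos ⟨hr, hs⟩, imNum_one_one ε hL hy]
      exact fockIdxCh_I_mul hpp hpm ε r s n y (by rw [hr1, hs1]; ring)
    · rw [imCh, if_neg (fun h => hs h.2), if_pos hr, imMinusCh, if_neg (fun h => h.1 hr),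
        zero_add, imNum_one_left ε hL hy, ← tsum_div_const]
      refine tsum_congr fun k => ?_
      rw [fockIdxCh_I_mul (t := n - 2 * k - 1 + s / pm) hpp hpm,
        fockIdxCh_I_mul (t := n - 2 * k - 1 - s / pm) hpp hpm, sub_div]
      · rw [hr1]; push_cast; field_simp; ring
      · rw [hr1]; push_cast; ring
  · by_cases hs : s = pm
    · refine ⟨fun _ => 0, tendsto_const_nhds, fun y hy => ?_⟩
      have hs1 : ((s : ℝ) / pm) = 1 := by rw [hs]; push_cast; field_simp
      rw [hs1, zero_add, imCh, if_neg (fun h => hr h.1), if_neg hr, if_pos hs, imPlusCh,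
        if_neg (fun h => h.1 hs), zero_add, imNum_comm, imNum_one_left ε hL hy, ← tsum_div_const]
      refine tsum_congr fun k => ?_
      rw [fockIdxCh_I_mul (t := n - 2 * k - 1 + r / pp) hpp hpm,
        fockIdxCh_I_mul (t := n - 2 * k - 1 - r / pp) hpp hpm, sub_div]
      · rw [hs1]; push_cast; ring
      · rw [hs1]; push_cast; field_simp; ring
    · refine ⟨fun y => if 0 ≤ n then (n : ℂ) * (if Even n then
          virNum (alphaFull pp pm) (r / pp) (s / pm) y else
          -virNum (alphaFull pp pm) (r / pp) ((pm - s : ℤ) / pm) y) else 0, ?_, fun y hy => ?_⟩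
      · have h1 := tendsto_virNum hL (r / pp) (s / pm)
        have h2 := tendsto_virNum hL (r / pp) ((pm - s : ℤ) / pm)
        split_ifs
        · simpa using h1.const_mul (n : ℂ)
        · simpa using h2.neg.const_mul (n : ℂ)
        · exact tendsto_const_nhds
      · rw [imCh, if_neg (fun h => hr h.1), if_neg hr, if_neg hs, add_div]
        congr 1
        · rw [virCh_I_mul hpp hpm, virCh_I_mul hpp hpm]
          split_ifs
          · ring
          · ring
          · simp
        · rw [← (hasSum_imNum ε hL hy _ _ _).tsum_eq, ← tsum_div_const]
          refine tsum_congr fun k => ?_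
          rw [fockIdxCh_I_mul (t := n + r / pp + s / pm - 2 * (k + 1)) hpp hpm,
            fockIdxCh_I_mul (t := n - r / pp - s / pm - 2 * (k + 1)) hpp hpm,
            fockIdxCh_I_mul (t := n - r / pp + s / pm - 2 * (k + 1)) hpp hpm,
            fockIdxCh_I_mul (t := n + r / pp - s / pm - 2 * (k + 1)) hpp hpm]
          · have key : ∀ t : ℝ, ((alphaFull pp pm / 2 * t : ℝ) : ℂ) -
                alphaFull pp pm * ((k : ℂ) + 1) =
                ((alphaFull pp pm / 2 * (t - 2 * (k + 1)) : ℝ) : ℂ) := fun t => by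
              push_cast; ring
            simp only [altSum, key]
            ring
          all_goals
            push_cast
            field_simp
            ring

/-- The character `∑_{j < r} e^{(r-1-2j)v}` of the `r`-dimensional representation of `SL₂`. -/
noncomputable def qsum (r : ℕ) (v : ℂ) : ℂ := ∑ j ∈ Finset.range r, exp ((r - 1 - 2 * j) * v)

lemma qsum_one (v : ℂ) : qsum 1 v = 1 := by simp [qsum]

lemma qsum_neg (r : ℕ) (v : ℂ) : qsum r (-v) = qsum r v := by
  rw [qsum, ← Finset.sum_range_reflect, qsum]
  refine Finset.sum_congr rfl fun j hj => ?_
  have hj' : j + 1 ≤ r := Finset.mem_range.1 hj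
  rw [Nat.sub_sub, Nat.cast_sub (by omega)]
  congr 1
  push_cast
  ring

lemma qsum_succ (r : ℕ) (v : ℂ) : qsum (r + 1) v = exp v * qsum r v + exp (-(r * v)) := by
  rw [qsum, Finset.sum_range_succ, qsum, Finset.mul_sum]
  congr 1
  · refine Finset.sum_congr rfl fun j _ => ?_
    rw [← Complex.exp_add]
    congr 1
    push_cast
    ring
  · congr 1
    push_cast
    ring

lemma qsum_succ' (r : ℕ) (v : ℂ) : qsum (r + 1) v = exp (-v) * qsum r v + exp (r * v) := by
  rw [← qsum_neg, qsum_succ, qsum_neg]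
  simp

lemma qsum_two (v : ℂ) : qsum 2 v = exp v + exp (-v) := by
  rw [qsum_succ, qsum_one]
  simp

lemma qsum_two_mul (r : ℕ) (v : ℂ) : qsum 2 v * qsum (r + 1) v = qsum r v + qsum (r + 2) v := by
  have h : exp (-v) * exp v = 1 := by rw [← Complex.exp_add]; simp
  have h2 : exp (-((r + 1 : ℕ) * v)) = exp (-v) * exp (-(r * v)) := by
    rw [← Complex.exp_add]; congr 1; push_cast; ring
  rw [qsum_two, qsum_succ (r + 1), h2, qsum_succ r]
  linear_combination qsum r v * h

lemma qsum_add_two (r : ℕ) (v : ℂ) :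
    qsum (r + 2) v = qsum r v + exp ((r + 1) * v) + exp (-((r + 1) * v)) := by
  have h : exp v * exp (-v) = 1 := by rw [← Complex.exp_add]; simp
  have h2 : exp ((r + 1) * v) = exp v * exp (r * v) := by
    rw [← Complex.exp_add]; congr 1; ring
  rw [qsum_succ (r + 1), qsum_succ' r, h2]
  push_cast
  linear_combination qsum r v * h

lemma qsum_mul_sinh (r : ℕ) (v : ℂ) : qsum r v * sinh v = sinh (r * v) := by
  induction r with
  | zero => simp [qsum]
  | succ r ih =>
    rw [qsum_succ, add_mul, mul_assoc, ih]
    have h : ((r + 1 : ℕ) : ℂ) * v = r * v + v := by push_cast; ring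
    rw [h, Complex.sinh_add, ← Complex.cosh_add_sinh v, ← Complex.cosh_sub_sinh]
    ring

lemma qsum_mul_cosh_of_sinh_eq_zero (r : ℕ) {v : ℂ} (hv : sinh v = 0) :
    qsum r v * cosh v = r * cosh (r * v) := by
  have hs : sinh (r * v) = 0 := by rw [← qsum_mul_sinh, hv, mul_zero]
  have hexp : exp (-v) = exp v := by
    rw [← Complex.cosh_sub_sinh, ← Complex.cosh_add_sinh v, hv]
    ring
  have hcosh : cosh v = exp v := by rw [← Complex.cosh_add_sinh v, hv, add_zero]
  have hcoshr : cosh (r * v) = exp (r * v) := by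
    rw [← Complex.cosh_add_sinh (r * v), hs, add_zero]
  have h1 : exp (-2 * v) = 1 := by
    rw [show -2 * v = -v + -v by ring, Complex.exp_add]
    nth_rw 2 [hexp]
    rw [← Complex.exp_add]
    simp
  have hterm : ∀ j : ℕ, exp ((r - 1 - 2 * j) * v) * exp v = exp (r * v) := fun j => by
    rw [← Complex.exp_add,
      show (r - 1 - 2 * j) * v + v = r * v + j * (-2 * v) by ring, Complex.exp_add,
      Complex.exp_nat_mul (-2 * v) j, h1, one_pow, mul_one]
  rw [hcosh, hcoshr, qsum, Finset.sum_mul, Finset.sum_congr rfl fun j _ => hterm j]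
  simp

/-- The regularised quantum dimension of `I_{r,s;n}` as a function of `u`. -/
noncomputable def imDim (pp pm : ℕ) (u : ℂ) (r s : ℕ) (n : ℤ) : ℂ :=
  exp (u * n) * (qsum r (u / pp) * qsum s (u / pm))

lemma sinh_mul_div (u : ℂ) (r p : ℕ) :
    sinh (u * ((r / p : ℝ) : ℂ)) = qsum r (u / p) * sinh (u * ((1 / p : ℝ) : ℂ)) := by
  have h : ∀ r : ℕ, u * ((r / p : ℝ) : ℂ) = r * (u / p) := fun r => by push_cast; ring
  have h1 : u * ((1 / p : ℝ) : ℂ) = u / p := by push_cast; ring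
  rw [h, h1, qsum_mul_sinh]

lemma imLimit_eq (pp pm : ℕ) (u : ℂ) (r s : ℕ) (n : ℤ) :
    imLimit u (r / pp) (s / pm) n = imDim pp pm u r s n * imLimit u (1 / pp) (1 / pm) 0 := by
  rw [imLimit, imLimit, imDim, sinh_mul_div, sinh_mul_div]
  simp
  ring

lemma sinh_pi_I_mul_div_eq_zero_iff {p : ℕ} (hp : 0 < p) (m : ℤ) :
    sinh (Real.pi * I * m * ((1 / p : ℝ) : ℂ)) = 0 ↔ (p : ℤ) ∣ m := by
  have hp' : (p : ℂ) ≠ 0 := by exact_mod_cast hp.ne'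
  have hπ : (Real.pi : ℂ) ≠ 0 := by exact_mod_cast Real.pi_ne_zero
  have h : (Real.pi * I * m * ((1 / p : ℝ) : ℂ) : ℂ) = (Real.pi * m / p) * I := by
    push_cast; ring
  rw [h, Complex.sinh_mul_I, mul_eq_zero, or_iff_left I_ne_zero, Complex.sin_eq_zero_iff]
  refine exists_congr fun k => ?_
  rw [div_eq_iff hp']
  constructor
  · intro hk
    have h2 : (m : ℂ) = p * k := by
      apply mul_left_cancel₀ hπ
      linear_combination hk
    exact_mod_cast h2
  · intro hk
    rw [hk]
    push_cast
    ring

lemma altSum_exp_dual {L : ℝ} (hL : 0 < L) (ρ κ n : ℝ) (m : ℤ) :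
    altSum L ρ κ n (fun a => exp (2 * Real.pi * I * m / L * a)) =
      4 * (exp (Real.pi * I * m * n) *
        (sinh (Real.pi * I * m * ρ) * sinh (Real.pi * I * m * κ))) := by
  have hL' : (L : ℂ) ≠ 0 := by exact_mod_cast hL.ne'
  exact altSum_exp _ _ _ _ _ _ (by field_simp)

lemma altSum_mul_exp_dual {L : ℝ} (hL : 0 < L) (ρ κ n : ℝ) (m : ℤ) :
    altSum L ρ κ n (fun a => a * exp (2 * Real.pi * I * m / L * a)) =
      2 * L * (exp (Real.pi * I * m * n) *
      (n * (sinh (Real.pi * I * m * ρ) * sinh (Real.pi * I * m * κ)) +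
        ρ * (cosh (Real.pi * I * m * ρ) * sinh (Real.pi * I * m * κ)) +
        κ * (sinh (Real.pi * I * m * ρ) * cosh (Real.pi * I * m * κ)))) := by
  have hL' : (L : ℂ) ≠ 0 := by exact_mod_cast hL.ne'
  exact altSum_mul_exp _ _ _ _ _ _ (by field_simp)

lemma dualCoeff_eq_zero {pp pm : ℕ} (hpp : 0 < pp) (hpm : 0 < pm) (ε : ℂ) {L : ℝ} (hL : 0 < L)
    (r s : ℕ) (n : ℝ) {m : ℤ} (hm : (pp * pm : ℤ) ∣ m) (y : ℝ) :
    dualCoeff ε L (r / pp) (s / pm) n m y = 0 := by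
  have h1 := (sinh_pi_I_mul_div_eq_zero_iff hpp m).2 ((Dvd.intro _ rfl).trans hm)
  have h2 := (sinh_pi_I_mul_div_eq_zero_iff hpm m).2 ((Dvd.intro_left _ rfl).trans hm)
  rw [dualCoeff, altSum_exp_dual hL, altSum_mul_exp_dual hL, sinh_mul_div, sinh_mul_div, h1, h2]
  simp

lemma neg_wall_le_wallDist (pp pm : ℕ) (ε : ℂ) {m : ℤ} (hm : ¬ (pp * pm : ℤ) ∣ m) :
    -wall pp pm ε ≤ wallDist pp pm ε m := by
  rw [wall, neg_neg]
  exact ciInf_le (f := fun m : {m : ℤ // ¬ ((pp * pm : ℤ) ∣ m)} => wallDist pp pm ε m)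
    ⟨0, by rintro _ ⟨_, rfl⟩; exact abs_nonneg _⟩ ⟨m, hm⟩

lemma re_sq_eq_sub_wallDist_sq (pp pm : ℕ) (ε : ℂ) (m : ℤ) :
    ((ε - I * m / alphaFull pp pm) ^ 2).re = ε.re ^ 2 - wallDist pp pm ε m ^ 2 := by
  rw [re_sq_sub_I_mul_div, wallDist, sq_abs]

/-- A scaling function `φ`, bounded as `y → 0⁺`, for which the numerators of the regularised
characters of the singlet modules have limits proportional to their quantum dimensions. -/
structure IsScaling (pp pm : ℕ) (ε u d ℓ : ℂ) (φ : ℝ → ℂ) : Prop where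
  ne_zero : ℓ ≠ 0
  tendsto : Tendsto φ (𝓝[>] 0) (𝓝 d)
  eventually_ne : ∀ᶠ y in 𝓝[>] 0, φ y ≠ 0
  tendsto_im : ∀ (r s : ℕ) (n : ℤ),
    Tendsto (fun y => φ y * imNum ε (alphaFull pp pm) (r / pp) (s / pm) n y) (𝓝[>] 0)
      (𝓝 (imDim pp pm u r s n * ℓ))

lemma sinh_mul_ofReal_ne_zero {z : ℂ} {t : ℝ} (hz : z.re ≠ 0) (ht : t ≠ 0) : sinh (z * t) ≠ 0 :=
  fun h => by
    have := re_eq_zero_of_sinh_eq_zero h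
    rw [Complex.re_mul_ofReal] at this
    exact (mul_ne_zero hz ht) this

/-- To the right of the wall, off the imaginary axis. -/
lemma isScaling_right {pp pm : ℕ} (hpp : 0 < pp) (hpm : 0 < pm) {ε : ℂ}
    (hw : wall pp pm ε < ε.re) (hε : ε.re ≠ 0) :
    IsScaling pp pm ε (Real.pi * ε * alphaFull pp pm) 1
      (imLimit (Real.pi * ε * alphaFull pp pm) (1 / pp) (1 / pm) 0) fun _ => 1 := by
  have hL := alphaFull_pos hpp hpm
  have hu : (Real.pi * ε * alphaFull pp pm).re ≠ 0 := by
    rw [mul_assoc, Complex.re_ofReal_mul, Complex.re_mul_ofReal]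
    exact mul_ne_zero Real.pi_ne_zero (mul_ne_zero hε hL.ne')
  have hpp' : (1 / pp : ℝ) ≠ 0 := by positivity
  have hpm' : (1 / pm : ℝ) ≠ 0 := by positivity
  refine ⟨?_, tendsto_const_nhds, Eventually.of_forall fun _ => one_ne_zero, fun r s n => ?_⟩
  · have h1 : sinh (Real.pi * ε * alphaFull pp pm) ≠ 0 := by
      simpa using sinh_mul_ofReal_ne_zero hu one_ne_zero
    exact div_ne_zero (mul_ne_zero (Complex.exp_ne_zero _) (mul_ne_zero
      (sinh_mul_ofReal_ne_zero hu hpp') (sinh_mul_ofReal_ne_zero hu hpm'))) (pow_ne_zero 2 h1)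
  · simp only [one_mul]
    rw [← imLimit_eq]
    rcases lt_or_gt_of_ne hε with h | h
    · refine tendsto_imNum_of_re_neg h hL _ _ _ fun m => ?_
      by_cases hm : (pp * pm : ℤ) ∣ m
      · exact Or.inl (dualCoeff_eq_zero hpp hpm ε hL r s n hm)
      · right
        have := neg_wall_le_wallDist pp pm ε hm
        rw [re_sq_eq_sub_wallDist_sq]
        nlinarith
    · exact tendsto_imNum_of_re_pos h hL _ _ _

lemma tendsto_dualCoeff (ε : ℂ) (L ρ κ n : ℝ) (m : ℤ) :
    Tendsto (dualCoeff ε L ρ κ n m) (𝓝[>] 0) (𝓝 (-(ε - I * m / L) *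
      altSum L ρ κ n (fun a => exp (2 * Real.pi * I * m / L * a)) / L ^ 2)) := by
  have h : Continuous (dualCoeff ε L ρ κ n m) := by unfold dualCoeff; fun_prop
  have h0 := h.tendsto 0
  rw [show dualCoeff ε L ρ κ n m 0 = -(ε - I * m / L) *
      altSum L ρ κ n (fun a => exp (2 * Real.pi * I * m / L * a)) / L ^ 2 by
    simp only [dualCoeff, Complex.ofReal_zero]; ring] at h0
  exact h0.mono_left nhdsWithin_le_nhds

lemma altSum_exp_dual_eq_imDim {L : ℝ} (hL : 0 < L) (pp pm r s : ℕ) (n m : ℤ) :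
    altSum L (r / pp) (s / pm) n (fun a => exp (2 * Real.pi * I * m / L * a)) =
      imDim pp pm (Real.pi * I * m) r s n * (4 * (sinh (Real.pi * I * m * ((1 / pp : ℝ) : ℂ)) *
        sinh (Real.pi * I * m * ((1 / pm : ℝ) : ℂ)))) := by
  rw [altSum_exp_dual hL, sinh_mul_div, sinh_mul_div, imDim]
  push_cast
  ring

lemma div_mul_cosh_of_sinh_eq_zero {u : ℂ} (r p : ℕ)
    (h : sinh (u * ((1 / p : ℝ) : ℂ)) = 0) :
    ((r / p : ℝ) : ℂ) * cosh (u * ((r / p : ℝ) : ℂ)) =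
      qsum r (u / p) * (((1 / p : ℝ) : ℂ) * cosh (u * ((1 / p : ℝ) : ℂ))) := by
  have h1 : u * ((1 / p : ℝ) : ℂ) = u / p := by push_cast; ring
  have hr : u * ((r / p : ℝ) : ℂ) = r * (u / p) := by push_cast; ring
  rw [h1] at h ⊢
  rw [hr]
  have := qsum_mul_cosh_of_sinh_eq_zero r h
  push_cast
  linear_combination (-(1 / p : ℂ)) * this

lemma cosh_ne_zero_of_sinh_eq_zero {z : ℂ} (h : sinh z = 0) : cosh z ≠ 0 := fun hc => by
  have := Complex.cosh_sq_sub_sinh_sq z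
  rw [h, hc] at this
  norm_num at this

/-- The amplitude of the dominating dual Gaussian when its leading term vanishes. -/
lemma altSum_mul_exp_dual_eq_imDim {L : ℝ} (hL : 0 < L) (pp pm : ℕ) (m : ℤ)
    (h : sinh (Real.pi * I * m * ((1 / pp : ℝ) : ℂ)) = 0 ∨
      sinh (Real.pi * I * m * ((1 / pm : ℝ) : ℂ)) = 0) (r s : ℕ) (n : ℤ) :
    altSum L (r / pp) (s / pm) n (fun a => a * exp (2 * Real.pi * I * m / L * a)) =
      imDim pp pm (Real.pi * I * m) r s n * (2 * L *
        (((1 / pp : ℝ) : ℂ) * cosh (Real.pi * I * m * ((1 / pp : ℝ) : ℂ)) *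
          sinh (Real.pi * I * m * ((1 / pm : ℝ) : ℂ)) +
        ((1 / pm : ℝ) : ℂ) * cosh (Real.pi * I * m * ((1 / pm : ℝ) : ℂ)) *
          sinh (Real.pi * I * m * ((1 / pp : ℝ) : ℂ)))) := by
  rw [altSum_mul_exp_dual hL, sinh_mul_div, sinh_mul_div, imDim]
  rcases h with h | h
  · have := div_mul_cosh_of_sinh_eq_zero r pp h
    rw [h]
    push_cast at this ⊢
    linear_combination (2 * L * exp (Real.pi * I * m * n) * (qsum s (Real.pi * I * m / pm) *
      sinh (Real.pi * I * m * (1 / pm)))) * this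
  · have := div_mul_cosh_of_sinh_eq_zero s pm h
    rw [h]
    push_cast at this ⊢
    linear_combination (2 * L * exp (Real.pi * I * m * n) * (qsum r (Real.pi * I * m / pp) *
      sinh (Real.pi * I * m * (1 / pp)))) * this

lemma tendsto_ofReal_zero : Tendsto (fun y : ℝ => (y : ℂ)) (𝓝[>] 0) (𝓝 0) := by
  have := (Complex.continuous_ofReal.tendsto 0).mono_left (nhdsWithin_le_nhds (s := Set.Ioi 0))
  simpa using this

lemma tendsto_ofReal_sqrt_zero : Tendsto (fun y : ℝ => ((Real.sqrt y : ℝ) : ℂ)) (𝓝[>] 0) (𝓝 0) := by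
  have h : Continuous fun y : ℝ => ((Real.sqrt y : ℝ) : ℂ) :=
    Complex.continuous_ofReal.comp Real.continuous_sqrt
  simpa using (h.tendsto 0).mono_left (nhdsWithin_le_nhds (s := Set.Ioi 0))

/-- To the left of the wall, when a single dual Gaussian dominates. -/
lemma exists_isScaling_left {pp pm : ℕ} (hpp : 0 < pp) (hpm : 0 < pm) (hcop : Nat.Coprime pp pm)
    {ε : ℂ} (hw : ε.re < wall pp pm ε) {m₀ : ℤ} (hm₀ : ¬ (pp * pm : ℤ) ∣ m₀)
    (hmin : wallDist pp pm ε m₀ = -wall pp pm ε)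
    (huniq : ∀ m : ℤ, ¬ (pp * pm : ℤ) ∣ m ∧ wallDist pp pm ε m = -wall pp pm ε → m = m₀) :
    ∃ ℓ φ, IsScaling pp pm ε (Real.pi * I * m₀) 0 ℓ φ := by
  have hL := alphaFull_pos hpp hpm
  set L := alphaFull pp pm with hLdef
  have hL' : (L : ℂ) ≠ 0 := by exact_mod_cast hL.ne'
  have hd0 : 0 ≤ wallDist pp pm ε m₀ := abs_nonneg _
  have hε : ε.re < 0 := by linarith
  have hpos : 0 < ((ε - I * m₀ / L) ^ 2).re := by
    rw [re_sq_eq_sub_wallDist_sq]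
    nlinarith
  have hlead := fun (r s : ℕ) (n : ℤ) => tendsto_imNum_sub_leading hε hL (r / pp) (s / pm) n m₀ hpos
    fun m hm => by
      by_cases hdvd : (pp * pm : ℤ) ∣ m
      · exact Or.inl (dualCoeff_eq_zero hpp hpm ε hL r s n hdvd)
      · right
        have h1 := neg_wall_le_wallDist pp pm ε hdvd
        have h2 : wallDist pp pm ε m ≠ -wall pp pm ε := fun h => hm (huniq m ⟨hdvd, h⟩)
        have h3 := lt_of_le_of_ne h1 h2.symm
        rw [re_sq_eq_sub_wallDist_sq, re_sq_eq_sub_wallDist_sq, hmin]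
        nlinarith
  set Φ : ℝ → ℂ := fun y => exp (-Real.pi * (ε - I * m₀ / L) ^ 2 / y) with hΦ
  have hΦ0 : Tendsto Φ (𝓝[>] 0) (𝓝 0) := tendsto_exp_neg_div hpos
  have hw0 : ε - I * m₀ / L ≠ 0 := fun h => by
    rw [h] at hpos
    simp at hpos
  have hy0 : ∀ y ∈ Set.Ioi (0 : ℝ), (y : ℂ) ≠ 0 ∧ ((Real.sqrt y : ℝ) : ℂ) ≠ 0 := fun y hy =>
    ⟨by exact_mod_cast (ne_of_gt hy), by exact_mod_cast (Real.sqrt_pos.2 hy).ne'⟩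
  by_cases hs : sinh (Real.pi * I * m₀ * ((1 / pp : ℝ) : ℂ)) = 0 ∨
      sinh (Real.pi * I * m₀ * ((1 / pm : ℝ) : ℂ)) = 0
  · refine ⟨2 * L * (((1 / pp : ℝ) : ℂ) * cosh (Real.pi * I * m₀ * ((1 / pp : ℝ) : ℂ)) *
          sinh (Real.pi * I * m₀ * ((1 / pm : ℝ) : ℂ)) +
        ((1 / pm : ℝ) : ℂ) * cosh (Real.pi * I * m₀ * ((1 / pm : ℝ) : ℂ)) *
          sinh (Real.pi * I * m₀ * ((1 / pp : ℝ) : ℂ))) / L ^ 2,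
      fun y => (Real.sqrt y : ℝ) * Φ y, ?_, ?_, ?_, fun r s n => ?_⟩
    · have hcopZ : IsCoprime (pp : ℤ) (pm : ℤ) := Nat.isCoprime_iff_coprime.2 hcop
      have hpp' : ((1 / pp : ℝ) : ℂ) ≠ 0 := by
        rw [Complex.ofReal_ne_zero]; positivity
      have hpm' : ((1 / pm : ℝ) : ℂ) ≠ 0 := by
        rw [Complex.ofReal_ne_zero]; positivity
      have hnot : ¬ (sinh (Real.pi * I * m₀ * ((1 / pp : ℝ) : ℂ)) = 0 ∧
          sinh (Real.pi * I * m₀ * ((1 / pm : ℝ) : ℂ)) = 0) := fun h =>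
        hm₀ (hcopZ.mul_dvd ((sinh_pi_I_mul_div_eq_zero_iff hpp m₀).1 h.1)
          ((sinh_pi_I_mul_div_eq_zero_iff hpm m₀).1 h.2))
      refine div_ne_zero (mul_ne_zero (mul_ne_zero two_ne_zero hL') ?_) (pow_ne_zero 2 hL')
      rcases hs with h | h
      · rw [h, mul_zero, add_zero]
        exact mul_ne_zero (mul_ne_zero hpp' (cosh_ne_zero_of_sinh_eq_zero h)) fun h' => hnot ⟨h, h'⟩
      · rw [h, mul_zero, zero_add]
        exact mul_ne_zero (mul_ne_zero hpm' (cosh_ne_zero_of_sinh_eq_zero h)) fun h' => hnot ⟨h', h⟩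
    · simpa using tendsto_ofReal_sqrt_zero.mul hΦ0
    · filter_upwards [self_mem_nhdsWithin] with y hy
      exact mul_ne_zero (hy0 y hy).2 (Complex.exp_ne_zero _)
    · have h := (tendsto_ofReal_sqrt_zero.mul (hlead r s n)).add_const
        (imDim pp pm (Real.pi * I * m₀) r s n * (2 * L *
        (((1 / pp : ℝ) : ℂ) * cosh (Real.pi * I * m₀ * ((1 / pp : ℝ) : ℂ)) *
          sinh (Real.pi * I * m₀ * ((1 / pm : ℝ) : ℂ)) +
        ((1 / pm : ℝ) : ℂ) * cosh (Real.pi * I * m₀ * ((1 / pm : ℝ) : ℂ)) *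
          sinh (Real.pi * I * m₀ * ((1 / pp : ℝ) : ℂ)))) / L ^ 2)
      rw [mul_zero, zero_add] at h
      rw [← mul_div_assoc]
      simp only [← hLdef]
      refine h.congr' ?_
      filter_upwards [self_mem_nhdsWithin] with y hy
      obtain ⟨h1, h2⟩ := hy0 y hy
      have hQ : altSum L (r / pp) (s / pm) n (fun a => exp (2 * Real.pi * I * m₀ / L * a)) = 0 := by
        rw [altSum_exp_dual_eq_imDim hL]
        rcases hs with hs | hs <;> rw [hs] <;> ring
      rw [dualCoeff, hQ, altSum_mul_exp_dual_eq_imDim hL pp pm m₀ hs]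
      generalize 2 * (L : ℂ) * _ = X
      simp only [hΦ]
      field_simp
      ring
  · push Not at hs
    refine ⟨-(ε - I * m₀ / L) * (4 * (sinh (Real.pi * I * m₀ * ((1 / pp : ℝ) : ℂ)) *
        sinh (Real.pi * I * m₀ * ((1 / pm : ℝ) : ℂ)))) / L ^ 2,
      fun y => y * (Real.sqrt y : ℝ) * Φ y, ?_, ?_, ?_, fun r s n => ?_⟩
    · exact div_ne_zero (mul_ne_zero (neg_ne_zero.2 hw0) (mul_ne_zero (by norm_num)
        (mul_ne_zero hs.1 hs.2))) (pow_ne_zero 2 hL')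
    · simpa using (tendsto_ofReal_zero.mul tendsto_ofReal_sqrt_zero).mul hΦ0
    · filter_upwards [self_mem_nhdsWithin] with y hy
      exact mul_ne_zero (mul_ne_zero (hy0 y hy).1 (hy0 y hy).2) (Complex.exp_ne_zero _)
    · have h := ((tendsto_ofReal_zero.mul tendsto_ofReal_sqrt_zero).mul (hlead r s n)).add
        (tendsto_dualCoeff ε L (r / pp) (s / pm) n m₀)
      rw [mul_zero, zero_add, altSum_exp_dual_eq_imDim hL] at h
      have e : ∀ a b c d : ℂ, a * (b * c / d) = b * (a * c) / d := by intros; ring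
      rw [e]
      simp only [← hLdef]
      refine h.congr' ?_
      filter_upwards [self_mem_nhdsWithin] with y hy
      obtain ⟨h1, h2⟩ := hy0 y hy
      simp only [hΦ]
      generalize exp (-Real.pi * (ε - I * m₀ / L) ^ 2 / y) = X
      field_simp
      ring

lemma eta_I_mul_ne_zero {y : ℝ} (hy : 0 < y) : ModularForm.eta (I * y) ≠ 0 :=
  ModularForm.eta_ne_zero (by simpa using hy)

/-- Existence of the quantum dimensions, and their values. -/
lemma exists_qdim {pp pm : ℕ} (hpp : 2 ≤ pp) (hpm : 2 ≤ pm) {ε u d ℓ : ℂ} {φ : ℝ → ℂ}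
    (h : IsScaling pp pm ε u d ℓ φ) :
    (∀ᶠ y : ℝ in 𝓝[>] (0 : ℝ), vacCh pp pm ε (I * y) ≠ 0) ∧
    (∀ lam : ℂ, HasQdim pp pm ε (fockCh pp pm ε lam)
      (exp (2 * Real.pi * ε * (lam - alphaZero pp pm / 2)) * (d / ℓ))) ∧
    ∀ (r s : ℕ) (n : ℤ), HasQdim pp pm ε (imCh pp pm ε r s n) (imDim pp pm u r s n) := by
  have hpp0 : 0 < pp := by omega
  have hpm0 : 0 < pm := by omega
  obtain ⟨V, hV, hVac⟩ := exists_imCh_I_mul hpp0 hpm0 ε 1 1 0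
  set W : ℝ → ℂ := fun y => virNum (alphaFull pp pm) ((1 : ℤ) / pp) ((1 : ℤ) / pm) y + V y +
    imNum ε (alphaFull pp pm) ((1 : ℤ) / pp) ((1 : ℤ) / pm) (0 : ℤ) y with hW
  have hWvac : ∀ y : ℝ, 0 < y → vacCh pp pm ε (I * y) = W y / ModularForm.eta (I * y) :=
    fun y hy => by
      rw [vacCh, virCh_I_mul hpp0 hpm0, hVac y hy, hW]
      ring
  have hlim : Tendsto (fun y => φ y * W y) (𝓝[>] 0) (𝓝 ℓ) := by
    have h1 := h.tendsto_im 1 1 0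
    have h2 : imDim pp pm u 1 1 0 = 1 := by simp [imDim, qsum_one]
    have h3 := (h.tendsto.mul ((tendsto_virNum (alphaFull_pos hpp0 hpm0) ((1 : ℤ) / pp)
      ((1 : ℤ) / pm)).add hV)).add h1
    rw [h2, one_mul, add_zero, mul_zero, zero_add] at h3
    refine h3.congr fun y => ?_
    simp only [hW]
    push_cast
    ring
  have hWne : ∀ᶠ y in 𝓝[>] (0 : ℝ), W y ≠ 0 := by
    filter_upwards [hlim.eventually_ne h.ne_zero] with y hy hy0
    exact hy (by rw [hy0, mul_zero])
  have hratio : ∀ (ch : ℂ → ℂ) (N : ℝ → ℂ) (x : ℂ),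
      (∀ y : ℝ, 0 < y → ch (I * y) = N y / ModularForm.eta (I * y)) →
      Tendsto (fun y => φ y * N y) (𝓝[>] 0) (𝓝 x) → HasQdim pp pm ε ch (x / ℓ) :=
    fun ch N x hch hN => by
      refine (hN.div hlim h.ne_zero).congr' ?_
      filter_upwards [self_mem_nhdsWithin, h.eventually_ne] with y hy hφ
      rw [hch y hy, hWvac y hy, div_div_div_cancel_right₀ (eta_I_mul_ne_zero hy)]
      exact mul_div_mul_left _ _ hφ
  refine ⟨?_, fun lam => ?_, fun r s n => ?_⟩
  · filter_upwards [self_mem_nhdsWithin, hWne] with y hy hne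
    rw [hWvac y hy]
    exact div_ne_zero hne (eta_I_mul_ne_zero hy)
  · rw [mul_div_left_comm, ← mul_div_assoc]
    exact hratio _ _ _ (fun y _ => fockCh_I_mul pp pm ε lam y) (h.tendsto.mul (tendsto_gauss _ _))
  · obtain ⟨V', hV', hch⟩ := exists_imCh_I_mul hpp0 hpm0 ε r s n
    have h1 := (h.tendsto.mul hV').add (h.tendsto_im r s n)
    rw [mul_zero, zero_add] at h1
    have h2 := hratio _ _ _ hch (h1.congr fun y => by push_cast; ring)
    rwa [mul_div_cancel_right₀ _ h.ne_zero] at h2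

/-- The quantum dimensions exist, with values of a uniform shape. -/
lemma Admissible.exists_qdim {pp pm : ℕ} (hpp : 2 ≤ pp) (hpm : 2 ≤ pm)
    (hcop : Nat.Coprime pp pm) {ε : ℂ} (hε : Admissible pp pm ε) :
    ∃ u c : ℂ, (c = 0 ∨ (u = Real.pi * ε * alphaFull pp pm ∧
      c = qsum pp (u / pp) * qsum pm (u / pm))) ∧
    (∀ᶠ y : ℝ in 𝓝[>] (0 : ℝ), vacCh pp pm ε (I * y) ≠ 0) ∧
    (∀ lam : ℂ, HasQdim pp pm ε (fockCh pp pm ε lam)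
      (exp (2 * Real.pi * ε * (lam - alphaZero pp pm / 2)) * c)) ∧
    ∀ (r s : ℕ) (n : ℤ), HasQdim pp pm ε (imCh pp pm ε r s n) (imDim pp pm u r s n) := by
  have hpp0 : 0 < pp := by omega
  have hpm0 : 0 < pm := by omega
  rcases hε with ⟨hw, hre⟩ | ⟨hw, m₀, ⟨hm₀, hmin⟩, huniq⟩
  · have h := isScaling_right hpp0 hpm0 hw hre
    refine ⟨_, _, Or.inr ⟨rfl, ?_⟩, Singlet.exists_qdim hpp hpm h⟩
    have hne := h.ne_zero
    set u := Real.pi * ε * alphaFull pp pm with hu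
    have key : ∀ p : ℕ, 0 < p → qsum p (u / p) * sinh (u * ((1 / p : ℝ) : ℂ)) = sinh u :=
      fun p hp => by
        rw [← sinh_mul_div]
        have : (p : ℝ) ≠ 0 := by positivity
        rw [div_self this]
        simp
    have hk1 := key pp hpp0
    have hk2 := key pm hpm0
    rw [imLimit] at hne ⊢
    have hs : sinh u ≠ 0 := fun h0 => hne (by rw [h0]; simp)
    rw [div_eq_iff hne, mul_div_assoc', eq_div_iff (pow_ne_zero 2 hs), ofReal_zero, mul_zero,
      Complex.exp_zero]
    linear_combination -(sinh u) * hk1 - qsum pp (u / pp) * sinh (u * ((1 / pp : ℝ) : ℂ)) * hk2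
  · obtain ⟨ℓ, φ, h⟩ := exists_isScaling_left hpp0 hpm0 hcop hw hm₀ hmin huniq
    have := Singlet.exists_qdim hpp hpm h
    rw [zero_div] at this
    exact ⟨_, 0, Or.inl rfl, this⟩

lemma imDim_one_one_mul (pp pm : ℕ) (u : ℂ) (r s : ℕ) (m n : ℤ) :
    imDim pp pm u 1 1 m * imDim pp pm u r s n = imDim pp pm u r s (m + n) := by
  simp only [imDim, qsum_one]
  push_cast
  rw [mul_add, Complex.exp_add]
  ring

lemma imDim_two_one_mul (pp pm : ℕ) (u : ℂ) (r s : ℕ) (n : ℤ) :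
    imDim pp pm u 2 1 0 * imDim pp pm u (r + 1) s n =
      imDim pp pm u r s n + imDim pp pm u (r + 2) s n := by
  have h := qsum_two_mul r (u / pp)
  simp only [imDim, qsum_one, Int.cast_zero, mul_zero, Complex.exp_zero]
  linear_combination exp (u * n) * qsum s (u / pm) * h

lemma imDim_one_two_mul (pp pm : ℕ) (u : ℂ) (r s : ℕ) (n : ℤ) :
    imDim pp pm u 1 2 0 * imDim pp pm u r (s + 1) n =
      imDim pp pm u r s n + imDim pp pm u r (s + 2) n := by
  have h := qsum_two_mul s (u / pm)
  simp only [imDim, qsum_one, Int.cast_zero, mul_zero, Complex.exp_zero]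
  linear_combination exp (u * n) * qsum r (u / pp) * h

lemma exp_mul_add_one_sub_one (u : ℂ) (n : ℤ) :
    exp (u * (n + 1 : ℤ)) = exp (u * n) * exp u ∧
      exp (u * (n - 1 : ℤ)) = exp (u * n) * exp (-u) := by
  rw [← Complex.exp_add, ← Complex.exp_add]
  constructor <;> congr 1 <;> push_cast <;> ring

lemma qsum_pred_add_two (p : ℕ) (u : ℂ) :
    qsum (p + 2) (u / (p + 1 : ℕ)) = qsum p (u / (p + 1 : ℕ)) + exp u + exp (-u) := by
  have hp : ((p : ℂ) + 1) ≠ 0 := by exact_mod_cast p.succ_ne_zero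
  have h : ((p : ℂ) + 1) * (u / (p + 1 : ℕ)) = u := by
    push_cast
    field_simp
  rw [qsum_add_two, h]

lemma imDim_two_one_mul_last (p pm : ℕ) (u : ℂ) (s : ℕ) (n : ℤ) :
    imDim (p + 1) pm u 2 1 0 * imDim (p + 1) pm u (p + 1) s n =
      imDim (p + 1) pm u 1 s (n - 1) + 2 * imDim (p + 1) pm u p s n +
        imDim (p + 1) pm u 1 s (n + 1) := by
  obtain ⟨h1, h2⟩ := exp_mul_add_one_sub_one u n
  rw [imDim_two_one_mul]
  simp only [imDim, qsum_one, qsum_pred_add_two, h1, h2]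
  ring

lemma imDim_one_two_mul_last (pp p : ℕ) (u : ℂ) (r : ℕ) (n : ℤ) :
    imDim pp (p + 1) u 1 2 0 * imDim pp (p + 1) u r (p + 1) n =
      imDim pp (p + 1) u r 1 (n - 1) + 2 * imDim pp (p + 1) u r p n +
        imDim pp (p + 1) u r 1 (n + 1) := by
  obtain ⟨h1, h2⟩ := exp_mul_add_one_sub_one u n
  rw [imDim_one_two_mul]
  simp only [imDim, qsum_one, qsum_pred_add_two, h1, h2]
  ring

lemma imDim_mul_exp {pp pm : ℕ} (hpp : 0 < pp) (hpm : 0 < pm) (ε x : ℂ) (r s : ℕ) (n : ℤ) :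
    imDim pp pm (Real.pi * ε * alphaFull pp pm) r s n * exp (2 * Real.pi * ε * x) =
      ∑ jp ∈ Finset.range r, ∑ jm ∈ Finset.range s,
        exp (2 * Real.pi * ε * (x + alphaIdx pp pm ((r : ℤ) - 2 * jp) ((s : ℤ) - 2 * jm) n)) := by
  rw [imDim, ← qsum_neg r, qsum, qsum, Finset.sum_mul_sum, Finset.mul_sum, Finset.sum_mul]
  refine Finset.sum_congr rfl fun jp _ => ?_
  rw [Finset.mul_sum, Finset.sum_mul]
  refine Finset.sum_congr rfl fun jm _ => ?_
  rw [← Complex.exp_add, ← Complex.exp_add, ← Complex.exp_add, alphaIdx, alphaPlus_eq hpp,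
    alphaMinus_eq hpm]
  congr 1
  push_cast
  ring

lemma qsum_mul_exp {pp pm : ℕ} (hpp : 0 < pp) (hpm : 0 < pm) (ε x : ℂ) :
    qsum pp (Real.pi * ε * alphaFull pp pm / pp) * qsum pm (Real.pi * ε * alphaFull pp pm / pm) *
      exp (2 * Real.pi * ε * (x - alphaZero pp pm / 2)) =
      ∑ jp ∈ Finset.range pp, ∑ jm ∈ Finset.range pm,
        exp (2 * Real.pi * ε * (x + jp * alphaPlus pp pm + jm * alphaMinus pp pm)) := by
  have hpp' : (pp : ℂ) ≠ 0 := by exact_mod_cast hpp.ne'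
  have hpm' : (pm : ℂ) ≠ 0 := by exact_mod_cast hpm.ne'
  rw [← qsum_neg pp, qsum, qsum, Finset.sum_mul_sum, Finset.sum_mul]
  refine Finset.sum_congr rfl fun jp _ => ?_
  rw [Finset.sum_mul]
  refine Finset.sum_congr rfl fun jm _ => ?_
  rw [← Complex.exp_add, ← Complex.exp_add, alphaZero, alphaPlus_eq hpp, alphaMinus_eq hpm]
  congr 1
  push_cast
  field_simp
  ring

end Singlet

theorem mainTheorem5 (pp pm : ℕ) (hpp : 2 ≤ pp) (hpm : 2 ≤ pm) (hcop : Nat.Coprime pp pm)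
    (ε : ℂ) (hε : Singlet.Admissible pp pm ε) :
    -- the quantum dimensions exist
    (∀ᶠ y : ℝ in 𝓝[>] (0 : ℝ), Singlet.vacCh pp pm ε (I * y) ≠ 0) ∧
    (∀ lam : ℂ,
      Singlet.HasQdim pp pm ε (Singlet.fockCh pp pm ε lam) (Singlet.qdimFock pp pm ε lam)) ∧
    (∀ r s : ℕ, 1 ≤ r → r ≤ pp → 1 ≤ s → s ≤ pm → ∀ n : ℤ,
      Singlet.HasQdim pp pm ε (Singlet.imCh pp pm ε r s n) (Singlet.qdimIm pp pm ε r s n)) ∧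
    -- products of two Fock modules
    (∀ lam mu : ℂ, Singlet.qdimFock pp pm ε lam * Singlet.qdimFock pp pm ε mu =
      ∑ jp ∈ Finset.range pp, ∑ jm ∈ Finset.range pm,
        Singlet.qdimFock pp pm ε
          (lam + mu + jp * Singlet.alphaPlus pp pm + jm * Singlet.alphaMinus pp pm)) ∧
    (∀ r s : ℕ, 1 ≤ r → r ≤ pp → 1 ≤ s → s ≤ pm → ∀ n : ℤ,
      -- product with a Fock module
      (∀ mu : ℂ, Singlet.qdimIm pp pm ε r s n * Singlet.qdimFock pp pm ε mu =
        ∑ jp ∈ Finset.range r, ∑ jm ∈ Finset.range s,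
          Singlet.qdimFock pp pm ε
            (mu + Singlet.alphaIdx pp pm ((r : ℤ) - 2 * jp) ((s : ℤ) - 2 * jm) n)) ∧
      -- product with `I_{1,1;m}`
      (∀ m : ℤ, Singlet.qdimIm pp pm ε 1 1 m * Singlet.qdimIm pp pm ε r s n =
        Singlet.qdimIm pp pm ε r s (m + n)) ∧
      -- product with `I_{2,1;0}`
      (r = 1 → Singlet.qdimIm pp pm ε 2 1 0 * Singlet.qdimIm pp pm ε r s n =
        Singlet.qdimIm pp pm ε 2 s n) ∧
      (1 < r → r < pp → Singlet.qdimIm pp pm ε 2 1 0 * Singlet.qdimIm pp pm ε r s n =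
        Singlet.qdimIm pp pm ε ((r : ℤ) - 1) s n + Singlet.qdimIm pp pm ε ((r : ℤ) + 1) s n) ∧
      (r = pp → Singlet.qdimIm pp pm ε 2 1 0 * Singlet.qdimIm pp pm ε r s n =
        Singlet.qdimIm pp pm ε 1 s (n - 1) + 2 * Singlet.qdimIm pp pm ε ((pp : ℤ) - 1) s n
          + Singlet.qdimIm pp pm ε 1 s (n + 1)) ∧
      -- product with `I_{1,2;0}`
      (s = 1 → Singlet.qdimIm pp pm ε 1 2 0 * Singlet.qdimIm pp pm ε r s n =
        Singlet.qdimIm pp pm ε r 2 n) ∧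
      (1 < s → s < pm → Singlet.qdimIm pp pm ε 1 2 0 * Singlet.qdimIm pp pm ε r s n =
        Singlet.qdimIm pp pm ε r ((s : ℤ) - 1) n + Singlet.qdimIm pp pm ε r ((s : ℤ) + 1) n) ∧
      (s = pm → Singlet.qdimIm pp pm ε 1 2 0 * Singlet.qdimIm pp pm ε r s n =
        Singlet.qdimIm pp pm ε r 1 (n - 1) + 2 * Singlet.qdimIm pp pm ε r ((pm : ℤ) - 1) n
          + Singlet.qdimIm pp pm ε r 1 (n + 1))) := by
  have hpp0 : 0 < pp := by omega
  have hpm0 : 0 < pm := by omega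
  obtain ⟨u, c, hc, hvac, hF, hI⟩ := hε.exists_qdim hpp hpm hcop
  have hqF : ∀ lam, Singlet.qdimFock pp pm ε lam =
      exp (2 * Real.pi * ε * (lam - Singlet.alphaZero pp pm / 2)) * c :=
    fun lam => (hF lam).limUnder_eq
  have hqI : ∀ (r s : ℕ) (n : ℤ), Singlet.qdimIm pp pm ε r s n = Singlet.imDim pp pm u r s n :=
    fun r s n => (hI r s n).limUnder_eq
  have hq1 : ∀ (s : ℕ) (n : ℤ), Singlet.qdimIm pp pm ε 1 s n = Singlet.imDim pp pm u 1 s n :=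
    fun s n => by exact_mod_cast hqI 1 s n
  have hq1' : ∀ (r : ℕ) (n : ℤ), Singlet.qdimIm pp pm ε r 1 n = Singlet.imDim pp pm u r 1 n :=
    fun r n => by exact_mod_cast hqI r 1 n
  have hq2 : ∀ (s : ℕ) (n : ℤ), Singlet.qdimIm pp pm ε 2 s n = Singlet.imDim pp pm u 2 s n :=
    fun s n => by exact_mod_cast hqI 2 s n
  have hq2' : ∀ (r : ℕ) (n : ℤ), Singlet.qdimIm pp pm ε r 2 n = Singlet.imDim pp pm u r 2 n :=
    fun r n => by exact_mod_cast hqI r 2 n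
  have hq11 : ∀ n : ℤ, Singlet.qdimIm pp pm ε 1 1 n = Singlet.imDim pp pm u 1 1 n :=
    fun n => by exact_mod_cast hqI 1 1 n
  have hq21 : Singlet.qdimIm pp pm ε 2 1 0 = Singlet.imDim pp pm u 2 1 0 := by
    exact_mod_cast hqI 2 1 0
  have hq12 : Singlet.qdimIm pp pm ε 1 2 0 = Singlet.imDim pp pm u 1 2 0 := by
    exact_mod_cast hqI 1 2 0
  refine ⟨hvac, fun lam => by rw [hqF]; exact hF lam,
    fun r s _ _ _ _ n => by rw [hqI]; exact hI r s n, fun lam mu => ?_, fun r s hr _ hs _ n =>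
    ⟨fun mu => ?_, fun m => ?_, fun h => ?_, fun h1 h2 => ?_, fun h => ?_, fun h => ?_,
      fun h1 h2 => ?_, fun h => ?_⟩⟩
  · simp only [hqF]
    rcases hc with rfl | ⟨rfl, hc⟩
    · simp
    · simp only [← Finset.sum_mul]
      have h := Singlet.qsum_mul_exp hpp0 hpm0 ε (lam + mu - Singlet.alphaZero pp pm / 2)
      have hexp : exp (2 * Real.pi * ε * (lam - Singlet.alphaZero pp pm / 2)) *
          exp (2 * Real.pi * ε * (mu - Singlet.alphaZero pp pm / 2)) =
          exp (2 * Real.pi * ε * (lam + mu - Singlet.alphaZero pp pm / 2 -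
            Singlet.alphaZero pp pm / 2)) := by
        rw [← Complex.exp_add]
        congr 1
        ring
      rw [mul_mul_mul_comm, hexp, ← mul_assoc]
      congr 1
      rw [hc, mul_comm, h]
      refine Finset.sum_congr rfl fun jp _ => Finset.sum_congr rfl fun jm _ => ?_
      congr 1
      ring
  · simp only [hqF, hqI]
    rcases hc with rfl | ⟨rfl, hc⟩
    · simp
    · simp only [← Finset.sum_mul]
      rw [← mul_assoc, Singlet.imDim_mul_exp hpp0 hpm0]
      congr 1
      refine Finset.sum_congr rfl fun jp _ => Finset.sum_congr rfl fun jm _ => ?_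
      congr 1
      ring
  · rw [hq11, hqI, hqI, Singlet.imDim_one_one_mul]
  · subst h
    rw [hq21, hqI, hq2, Singlet.imDim_two_one_mul pp pm u 0 s n]
    simp [Singlet.imDim, Singlet.qsum]
  · obtain ⟨r, rfl⟩ : ∃ k, r = k + 1 := ⟨r - 1, by omega⟩
    have e1 : ((r + 1 : ℕ) : ℤ) - 1 = r := by push_cast; ring
    have e2 : ((r + 1 : ℕ) : ℤ) + 1 = (r + 2 : ℕ) := by push_cast; ring
    rw [hq21, hqI, e1, e2, hqI, hqI, Singlet.imDim_two_one_mul]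
  · obtain ⟨p, rfl⟩ : ∃ k, pp = k + 1 := ⟨pp - 1, by omega⟩
    subst h
    have e1 : ((p + 1 : ℕ) : ℤ) - 1 = p := by push_cast; ring
    rw [hq21, hqI, e1, hqI, hq1, hq1, Singlet.imDim_two_one_mul_last]
  · subst h
    rw [hq12, hqI, hq2', Singlet.imDim_one_two_mul pp pm u r 0 n]
    simp [Singlet.imDim, Singlet.qsum]
  · obtain ⟨s, rfl⟩ : ∃ k, s = k + 1 := ⟨s - 1, by omega⟩
    have e1 : ((s + 1 : ℕ) : ℤ) - 1 = s := by push_cast; ring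
    have e2 : ((s + 1 : ℕ) : ℤ) + 1 = (s + 2 : ℕ) := by push_cast; ring
    rw [hq12, hqI, e1, e2, hqI, hqI, Singlet.imDim_one_two_mul]
  · obtain ⟨p, rfl⟩ : ∃ k, pm = k + 1 := ⟨pm - 1, by omega⟩
    subst h
    have e1 : ((p + 1 : ℕ) : ℤ) - 1 = p := by push_cast; ring
    rw [hq12, hqI, e1, hqI, hq1', hq1', Singlet.imDim_one_two_mul_last]
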